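/- Let $p,r\ge 0$ be integers, $\lambda_1,\lambda_2>0$, and let $\mathcal G$ be a finite set of groups (subsets) of the pixels $\{1,\dots,p\}$. For $\mathbf s\in\mathbb R^p$ put $\|\mathbf s\|_{\ell_1/\ell_\infty}=\sum_{g\in\mathcal G}\|\mathbf s_{|g}\|_\infty$, where $\mathbf s_{|g}$ agrees with $\mathbf s$ on $g$ and vanishes elsewhere. For $\mathbf d,\mathbf s\in\mathbb R^p$, $\mathbf L\in\mathbb R^{p\times r}$, $\mathbf r\in\mathbb R^r$ put $$\hat\ell(\mathbf d,\mathbf L,\mathbf r,\mathbf s)=\tfrac12\|\mathbf d-\mathbf L\mathbf r-\mathbf s\|_2^2+\tfrac{\lambda_1}{2}\|\mathbf r\|_2^2+\lambda_2\|\mathbf s\|_{\ell_1/\ell_\infty}.$$ Let $\mathbf d_1,\mathbf d_2,\dots$ be i.i.d. random vectors in $\mathbb R^p$ (the frames) that are uniformly bounded: there is a constant $C$ with $\|\mathbf d_t\|\le C$ almost surely for all $t$. Let $\mathbf L_0$ be a random $p\times r$ matrix such that, for some integer $k\ge 0$, $(\mathbf L_0,\mathbf d_1,\dots,\mathbf d_k)$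 is independent of $(\mathbf d_t)_{t>k}$; for instance, $\mathbf L_0$ is deterministic, or random and independent of the frames, or computed from the first $k$ frames. The O-LSD algorithm starts from $\mathbf L_0$, $\mathbf A_0=0$, $\mathbf B_0=0$ and does the following for $t=1,2,\dots$: 1. $(\mathbf r_t,\mathbf s_t)\in\operatorname{argmin}_{\mathbf r,\mathbf s}\hat\ell(\mathbf d_t,\mathbf L_{t-1},\mathbf r,\mathbf s)$; 2. $\mathbf A_t=\mathbf A_{t-1}+\mathbf r_t\mathbf r_t^T$ and $\mathbf B_t=\mathbf B_{t-1}+(\mathbf d_t-\mathbf s_t)\mathbf r_t^T$; 3. $\mathbf L_t\in\operatorname{argmin}_{\mathbf L\in\mathbb R^{p\times r}}\ \operatorname{tr}\bigl(\mathbf L(\lambda_1\mathbf I+\mathbf A_t)\mathbf L^T\bigr)-2\operatorname{tr}(\mathbf L^T\mathbf B_t)$. For $t\ge 1$ define the surrogate function $$g_t(\mathbf L)=\frac1t\sum_{i=1}^t\hat\ell(\mathbf d_i,\mathbf L,\mathbf r_i,\mathbf s_i)+\frac{\lambda_1}{2t}\|\mathbf L\|_F^2 .$$ Then the sequence $g_t(\mathbf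 L_t)$ converges (to a finite limit) almost surely as $t\to\infty$. -/

import Mathlib

open MeasureTheory ProbabilityTheory Filter Topology Matrix

namespace OLSD

/-- Squared Euclidean norm `‖v‖₂²` of a vector. -/
def sqNorm {n : ℕ} (v : Fin n → ℝ) : ℝ := ∑ i, v i ^ 2

/-- Squared Frobenius norm `‖M‖_F²` of a matrix. -/
def sqFrob {m n : ℕ} (M : Matrix (Fin m) (Fin n) ℝ) : ℝ := ∑ i, ∑ j, M i j ^ 2

/-- The structured sparsity norm `‖s‖_{ℓ₁/ℓ_∞} = ∑_{g ∈ G} ‖s_{|g}‖_∞`, with unit group weights.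
Here `s_{|g}` agrees with `s` on `g` and is zero elsewhere, and the norm on `Fin p → ℝ` is
the sup norm. -/
noncomputable def groupNorm {p : ℕ} (G : Finset (Finset (Fin p))) (s : Fin p → ℝ) : ℝ :=
  ∑ g ∈ G, ‖(g : Set (Fin p)).indicator s‖

/-- The reconstruction cost of a frame `d` for given basis `L`, coefficients `r`, foreground `s`:
`½ ‖d - L r - s‖₂² + (lam1 / 2) ‖r‖₂² + lam2 ‖s‖_{ℓ₁/ℓ_∞}`. -/
noncomputable def frameCost {p q : ℕ} (G : Finset (Finset (Fin p))) (lam1 lam2 : ℝ)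
    (d : Fin p → ℝ) (L : Matrix (Fin p) (Fin q) ℝ) (r : Fin q → ℝ) (s : Fin p → ℝ) : ℝ :=
  1 / 2 * sqNorm (d - L *ᵥ r - s) + lam1 / 2 * sqNorm r + lam2 * groupNorm G s

/-- The objective of the subspace basis update:
`tr (L (lam1 I + A) Lᵀ) - 2 tr (Lᵀ B)`. -/
def basisObjective {p q : ℕ} (lam1 : ℝ) (A : Matrix (Fin q) (Fin q) ℝ)
    (B : Matrix (Fin p) (Fin q) ℝ) (L : Matrix (Fin p) (Fin q) ℝ) : ℝ :=
  (L * (lam1 • (1 : Matrix (Fin q) (Fin q) ℝ) + A) * Lᵀ).trace - 2 * (Lᵀ * B).trace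

/-- `(r, s, A, B, L)` is a run of the O-LSD algorithm on the frame sequence `d`, started at the
basis `L 0`. Frames are numbered from zero: `d t`, `r t`, `s t` belong to the `(t + 1)`-st frame,
while `A t`, `B t`, `L t` are the accumulation matrices and the basis after `t` frames. -/
structure IsRun {p q : ℕ} (G : Finset (Finset (Fin p))) (lam1 lam2 : ℝ)
    (d : ℕ → Fin p → ℝ) (r : ℕ → Fin q → ℝ) (s : ℕ → Fin p → ℝ)
    (A : ℕ → Matrix (Fin q) (Fin q) ℝ) (B L : ℕ → Matrix (Fin p) (Fin q) ℝ) : Prop where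
  A_zero : A 0 = 0
  B_zero : B 0 = 0
  /-- Foreground and background separation: `(r, s)` minimizes the cost of the new frame for
  the previous basis. -/
  separation : ∀ t (r' : Fin q → ℝ) (s' : Fin p → ℝ),
    frameCost G lam1 lam2 (d t) (L t) (r t) (s t) ≤ frameCost G lam1 lam2 (d t) (L t) r' s'
  A_succ : ∀ t, A (t + 1) = A t + vecMulVec (r t) (r t)
  B_succ : ∀ t, B (t + 1) = B t + vecMulVec (d t - s t) (r t)
  /-- Subspace basis update. -/
  update : ∀ t (L' : Matrix (Fin p) (Fin q) ℝ),
    basisObjective lam1 (A (t + 1)) (B (t + 1)) (L (t + 1)) ≤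
      basisObjective lam1 (A (t + 1)) (B (t + 1)) L'

/-- The surrogate function after `t` frames (used for `t ≥ 1`):
`g_t(M) = (1/t) ∑_{i=1}^t cost(d_i, M, r_i, s_i) + (lam1 / (2t)) ‖M‖_F²`. -/
noncomputable def surrogate {p q : ℕ} (G : Finset (Finset (Fin p))) (lam1 lam2 : ℝ)
    (d : ℕ → Fin p → ℝ) (r : ℕ → Fin q → ℝ) (s : ℕ → Fin p → ℝ) (t : ℕ)
    (M : Matrix (Fin p) (Fin q) ℝ) : ℝ :=
  1 / (t : ℝ) * ∑ i ∈ Finset.range t, frameCost G lam1 lam2 (d i) M (r i) (s i)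
    + lam1 / (2 * (t : ℝ)) * sqFrob M

end OLSD

namespace OLSD

section Norms

variable {m n : ℕ}

lemma sqNorm_nonneg (v : Fin n → ℝ) : 0 ≤ sqNorm v :=
  Finset.sum_nonneg fun _ _ => sq_nonneg _

lemma sqFrob_nonneg (M : Matrix (Fin m) (Fin n) ℝ) : 0 ≤ sqFrob M :=
  Finset.sum_nonneg fun _ _ => Finset.sum_nonneg fun _ _ => sq_nonneg _

lemma groupNorm_nonneg (G : Finset (Finset (Fin n))) (s : Fin n → ℝ) : 0 ≤ groupNorm G s :=
  Finset.sum_nonneg fun _ _ => norm_nonneg _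

lemma sqNorm_zero : sqNorm (0 : Fin n → ℝ) = 0 := by simp [sqNorm]

lemma groupNorm_zero (G : Finset (Finset (Fin n))) : groupNorm G 0 = 0 := by
  simp [groupNorm]

lemma sqNorm_add_le {η : ℝ} (hη : 0 < η) (u v : Fin n → ℝ) :
    sqNorm (u + v) ≤ (1 + η) * sqNorm u + (1 + 1 / η) * sqNorm v := by
  simp only [sqNorm, Finset.mul_sum, ← Finset.sum_add_distrib]
  refine Finset.sum_le_sum fun i _ => ?_
  have h : 0 ≤ (η * u i - v i) ^ 2 / η := by positivity
  have e : (1 + η) * u i ^ 2 + (1 + 1 / η) * v i ^ 2 - (u i + v i) ^ 2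
      = (η * u i - v i) ^ 2 / η := by
    field_simp
    ring
  simp only [Pi.add_apply]
  linarith

lemma sqNorm_midpoint (u v : Fin n → ℝ) :
    sqNorm ((1 / 2 : ℝ) • (u + v)) + 1 / 4 * sqNorm (u - v) = (sqNorm u + sqNorm v) / 2 := by
  simp only [sqNorm, Finset.mul_sum, ← Finset.sum_add_distrib, Finset.sum_div]
  refine Finset.sum_congr rfl fun i _ => ?_
  simp only [Pi.smul_apply, Pi.add_apply, Pi.sub_apply, smul_eq_mul]
  ring

lemma sqFrob_eq_sum_sqNorm (M : Matrix (Fin m) (Fin n) ℝ) : sqFrob M = ∑ i, sqNorm (M i) := rfl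

lemma sqFrob_midpoint (M N : Matrix (Fin m) (Fin n) ℝ) :
    sqFrob ((1 / 2 : ℝ) • (M + N)) + 1 / 4 * sqFrob (M - N) = (sqFrob M + sqFrob N) / 2 := by
  simp only [sqFrob_eq_sum_sqNorm, Finset.mul_sum, ← Finset.sum_add_distrib, Finset.sum_div]
  exact Finset.sum_congr rfl fun i _ => sqNorm_midpoint (M i) (N i)

lemma groupNorm_midpoint_le (G : Finset (Finset (Fin n))) (s s' : Fin n → ℝ) :
    groupNorm G ((1 / 2 : ℝ) • (s + s')) ≤ (groupNorm G s + groupNorm G s') / 2 := by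
  simp only [groupNorm, ← Finset.sum_add_distrib, Finset.sum_div]
  refine Finset.sum_le_sum fun g _ => ?_
  have e : (g : Set (Fin n)).indicator ((1 / 2 : ℝ) • (s + s'))
      = (1 / 2 : ℝ) • ((g : Set (Fin n)).indicator s + (g : Set (Fin n)).indicator s') := by
    ext i
    by_cases hi : i ∈ g <;> simp [hi, mul_add]
  rw [e, norm_smul]
  have := norm_add_le ((g : Set (Fin n)).indicator s) ((g : Set (Fin n)).indicator s')
  norm_num
  linarith

lemma sqNorm_le_of_abs_le {v : Fin n → ℝ} {c : ℝ} (h : ∀ i, |v i| ≤ c) :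
    sqNorm v ≤ n * c ^ 2 := by
  have : ∀ i ∈ Finset.univ, v i ^ 2 ≤ c ^ 2 := fun i _ => sq_le_sq' (neg_le_of_abs_le (h i))
    (le_of_abs_le (h i))
  simpa [sqNorm] using Finset.sum_le_sum this

lemma tendsto_zero_of_sqNorm {v : ℕ → Fin n → ℝ}
    (h : Tendsto (fun k => sqNorm (v k)) atTop (𝓝 0)) : Tendsto v atTop (𝓝 0) := by
  rw [tendsto_pi_nhds]
  intro i
  refine squeeze_zero_norm (a := fun k => √(sqNorm (v k))) (fun k => ?_) ?_
  · exact Real.abs_le_sqrt (Finset.single_le_sum (f := fun j => v k j ^ 2)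
      (fun _ _ => sq_nonneg _) (Finset.mem_univ i))
  · simpa using h.sqrt

lemma tendsto_zero_of_sqFrob {M : ℕ → Matrix (Fin m) (Fin n) ℝ}
    (h : Tendsto (fun k => sqFrob (M k)) atTop (𝓝 0)) : Tendsto M atTop (𝓝 0) := by
  refine tendsto_pi_nhds.2 fun i => ?_
  refine tendsto_zero_of_sqNorm (squeeze_zero (fun k => sqNorm_nonneg _) (fun k => ?_) h)
  exact Finset.single_le_sum (f := fun i => sqNorm (M k i)) (fun _ _ => sqNorm_nonneg _)
    (Finset.mem_univ i)

end Norms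

section FrameCost

variable {p q : ℕ} {G : Finset (Finset (Fin p))} {lam1 lam2 : ℝ}

lemma frameCost_nonneg (h1 : 0 < lam1) (h2 : 0 < lam2) (d : Fin p → ℝ)
    (L : Matrix (Fin p) (Fin q) ℝ) (r : Fin q → ℝ) (s : Fin p → ℝ) :
    0 ≤ frameCost G lam1 lam2 d L r s := by
  have := sqNorm_nonneg (d - L *ᵥ r - s)
  have := sqNorm_nonneg r
  have := groupNorm_nonneg G s
  unfold frameCost
  positivity

lemma frameCost_midpoint_le (h2 : 0 < lam2) (d : Fin p → ℝ)
    (L : Matrix (Fin p) (Fin q) ℝ) (r r' : Fin q → ℝ) (s s' : Fin p → ℝ) :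
    frameCost G lam1 lam2 d L ((1 / 2 : ℝ) • (r + r')) ((1 / 2 : ℝ) • (s + s'))
      + 1 / 8 * (sqNorm (L *ᵥ (r - r') + (s - s')) + lam1 * sqNorm (r - r'))
      ≤ (frameCost G lam1 lam2 d L r s + frameCost G lam1 lam2 d L r' s') / 2 := by
  have e1 := sqNorm_midpoint (d - L *ᵥ r' - s') (d - L *ᵥ r - s)
  have e2 := sqNorm_midpoint r r'
  have e3 := groupNorm_midpoint_le G s s'
  have a1 : (d - L *ᵥ r' - s') - (d - L *ᵥ r - s) = L *ᵥ (r - r') + (s - s') := by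
    rw [mulVec_sub]; abel
  have a2 : (1 / 2 : ℝ) • ((d - L *ᵥ r' - s') + (d - L *ᵥ r - s))
      = d - L *ᵥ ((1 / 2 : ℝ) • (r + r')) - (1 / 2 : ℝ) • (s + s') := by
    rw [mulVec_smul, mulVec_add]; module
  rw [a1, a2] at e1
  unfold frameCost
  have := mul_le_mul_of_nonneg_left e3 h2.le
  linear_combination (1 / 2) * e1 + lam1 / 2 * e2 + this

lemma tendsto_of_frameCost_tendsto (h1 : 0 < lam1) (h2 : 0 < lam2) {d : Fin p → ℝ}
    {L : Matrix (Fin p) (Fin q) ℝ} {r : Fin q → ℝ} {s : Fin p → ℝ}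
    (hmin : ∀ r' s', frameCost G lam1 lam2 d L r s ≤ frameCost G lam1 lam2 d L r' s')
    {z : ℕ → (Fin q → ℝ) × (Fin p → ℝ)}
    (hz : Tendsto (fun n => frameCost G lam1 lam2 d L (z n).1 (z n).2) atTop
      (𝓝 (frameCost G lam1 lam2 d L r s))) :
    Tendsto z atTop (𝓝 (r, s)) := by
  have key : ∀ n, sqNorm (L *ᵥ ((z n).1 - r) + ((z n).2 - s)) + lam1 * sqNorm ((z n).1 - r)
      ≤ 4 * (frameCost G lam1 lam2 d L (z n).1 (z n).2 - frameCost G lam1 lam2 d L r s) := by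
    intro n
    have := frameCost_midpoint_le (G := G) (lam1 := lam1) h2 d L (z n).1 r (z n).2 s
    have := hmin ((1 / 2 : ℝ) • ((z n).1 + r)) ((1 / 2 : ℝ) • ((z n).2 + s))
    linarith
  have h0 : Tendsto (fun n => 4 * (frameCost G lam1 lam2 d L (z n).1 (z n).2
      - frameCost G lam1 lam2 d L r s)) atTop (𝓝 0) := by
    simpa using (hz.sub_const (frameCost G lam1 lam2 d L r s)).const_mul 4
  have hr : Tendsto (fun n => (z n).1 - r) atTop (𝓝 0) := by
    apply tendsto_zero_of_sqNorm
    have : Tendsto (fun n => lam1 * sqNorm ((z n).1 - r)) atTop (𝓝 0) :=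
      squeeze_zero (fun n => mul_nonneg h1.le (sqNorm_nonneg _))
        (fun n => by linarith [key n, sqNorm_nonneg (L *ᵥ ((z n).1 - r) + ((z n).2 - s))]) h0
    simpa [h1.ne'] using this.const_mul lam1⁻¹
  have hrs : Tendsto (fun n => L *ᵥ ((z n).1 - r) + ((z n).2 - s)) atTop (𝓝 0) := by
    apply tendsto_zero_of_sqNorm
    exact squeeze_zero (fun n => sqNorm_nonneg _)
        (fun n => by linarith [key n, mul_nonneg h1.le (sqNorm_nonneg ((z n).1 - r))]) h0
  have hL : Tendsto (fun n => L *ᵥ ((z n).1 - r)) atTop (𝓝 0) := by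
    have hc : Continuous fun v : Fin q → ℝ => L *ᵥ v := by fun_prop
    simpa [Function.comp_def] using (hc.tendsto 0).comp hr
  have hs : Tendsto (fun n => (z n).2 - s) atTop (𝓝 0) := by
    simpa using hrs.sub hL
  have hr' := hr.add_const r
  have hs' := hs.add_const s
  simp only [sub_add_cancel, zero_add] at hr' hs'
  exact hr'.prodMk_nhds hs'

lemma continuous_frameCost :
    Continuous fun x : ((Fin p → ℝ) × (Fin p → Fin q → ℝ)) × (Fin q → ℝ) × (Fin p → ℝ) =>
      frameCost G lam1 lam2 x.1.1 (Matrix.of x.1.2) x.2.1 x.2.2 := by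
  have hi : ∀ g : Finset (Fin p),
      Continuous fun s : Fin p → ℝ => (g : Set (Fin p)).indicator s := by
    intro g
    refine continuous_pi fun i => ?_
    by_cases hi : i ∈ g
    · simpa [Set.indicator, hi] using continuous_apply i
    · simpa [Set.indicator, hi] using continuous_const
  have hg : Continuous (groupNorm G) := by
    unfold groupNorm
    exact continuous_finsetSum _ fun g _ => (hi g).norm
  unfold frameCost sqNorm mulVec dotProduct
  simp only [Matrix.of_apply, Pi.sub_apply]
  have := hg.comp (continuous_snd.comp (continuous_snd (X :=
    (Fin p → ℝ) × (Fin p → Fin q → ℝ)) (Y := (Fin q → ℝ) × (Fin p → ℝ))))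
  simp only [Function.comp_def] at this
  refine Continuous.add (by fun_prop) (this.const_mul lam2)

/-- The optimal reconstruction cost of the frame `d` for the basis `L`. -/
noncomputable def optCost (G : Finset (Finset (Fin p))) (lam1 lam2 : ℝ) (d : Fin p → ℝ)
    (L : Matrix (Fin p) (Fin q) ℝ) : ℝ :=
  ⨅ z : (Fin q → ℝ) × (Fin p → ℝ), frameCost G lam1 lam2 d L z.1 z.2

lemma optCost_le (h1 : 0 < lam1) (h2 : 0 < lam2) (d : Fin p → ℝ)
    (L : Matrix (Fin p) (Fin q) ℝ) (r : Fin q → ℝ) (s : Fin p → ℝ) :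
    optCost G lam1 lam2 d L ≤ frameCost G lam1 lam2 d L r s :=
  ciInf_le (f := fun z : (Fin q → ℝ) × (Fin p → ℝ) => frameCost G lam1 lam2 d L z.1 z.2)
    ⟨0, by rintro _ ⟨z, rfl⟩; exact frameCost_nonneg h1 h2 _ _ _ _⟩ (r, s)

lemma optCost_nonneg (h1 : 0 < lam1) (h2 : 0 < lam2) (d : Fin p → ℝ)
    (L : Matrix (Fin p) (Fin q) ℝ) : 0 ≤ optCost G lam1 lam2 d L :=
  le_ciInf fun _ => frameCost_nonneg h1 h2 _ _ _ _

lemma optCost_le_half_sqNorm (h1 : 0 < lam1) (h2 : 0 < lam2) (d : Fin p → ℝ)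
    (L : Matrix (Fin p) (Fin q) ℝ) : optCost G lam1 lam2 d L ≤ 1 / 2 * sqNorm d := by
  refine (optCost_le h1 h2 d L 0 0).trans_eq ?_
  simp [frameCost, sqNorm_zero, groupNorm_zero]

lemma optCost_perturb (h1 : 0 < lam1) (h2 : 0 < lam2) {η : ℝ} (hη : 0 < η)
    (d d' : Fin p → ℝ) (L : Matrix (Fin p) (Fin q) ℝ) :
    optCost G lam1 lam2 d L
      ≤ (1 + η) * optCost G lam1 lam2 d' L + 1 / 2 * (1 + 1 / η) * sqNorm (d - d') := by
  have h : ∀ z : (Fin q → ℝ) × (Fin p → ℝ),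
      (optCost G lam1 lam2 d L - 1 / 2 * (1 + 1 / η) * sqNorm (d - d')) / (1 + η)
        ≤ frameCost G lam1 lam2 d' L z.1 z.2 := by
    intro z
    rw [div_le_iff₀ (by positivity)]
    have a := optCost_le (G := G) h1 h2 d L z.1 z.2
    have b := sqNorm_add_le hη (d' - L *ᵥ z.1 - z.2) (d - d')
    have e : d' - L *ᵥ z.1 - z.2 + (d - d') = d - L *ᵥ z.1 - z.2 := by abel
    rw [e] at b
    have c1 : 0 ≤ η * (lam1 * sqNorm z.1) :=
      mul_nonneg hη.le (mul_nonneg h1.le (sqNorm_nonneg _))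
    have c2 : 0 ≤ η * (lam2 * groupNorm G z.2) :=
      mul_nonneg hη.le (mul_nonneg h2.le (groupNorm_nonneg _ _))
    unfold frameCost at a ⊢
    linarith
  have := le_ciInf h
  rw [div_le_iff₀ (by positivity)] at this
  change _ ≤ optCost G lam1 lam2 d' L * (1 + η) at this
  linarith

lemma optCost_eq_of_isMin (h1 : 0 < lam1) (h2 : 0 < lam2) {d : Fin p → ℝ}
    {L : Matrix (Fin p) (Fin q) ℝ} {r : Fin q → ℝ} {s : Fin p → ℝ}
    (hmin : ∀ r' s', frameCost G lam1 lam2 d L r s ≤ frameCost G lam1 lam2 d L r' s') :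
    frameCost G lam1 lam2 d L r s = optCost G lam1 lam2 d L :=
  le_antisymm (le_ciInf fun _ => hmin _ _) (optCost_le h1 h2 _ _ _ _)

end FrameCost

section BasisUpdate

variable {p q : ℕ} {G : Finset (Finset (Fin p))} {lam1 lam2 : ℝ}

/-- Twice the part of `t` times the surrogate that depends on the basis. -/
noncomputable def ridgeObjective (lam1 : ℝ) (x : ℕ → Fin p → ℝ) (r : ℕ → Fin q → ℝ) (t : ℕ)
    (M : Matrix (Fin p) (Fin q) ℝ) : ℝ :=
  ∑ i ∈ Finset.range t, sqNorm (x i - M *ᵥ r i) + lam1 * sqFrob M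

lemma basisObjective_add_vecMulVec (A : Matrix (Fin q) (Fin q) ℝ) (B M : Matrix (Fin p) (Fin q) ℝ)
    (r : Fin q → ℝ) (x : Fin p → ℝ) :
    basisObjective lam1 (A + vecMulVec r r) (B + vecMulVec x r) M
      = basisObjective lam1 A B M + (sqNorm (x - M *ᵥ r) - sqNorm x) := by
  have e : sqNorm (x - M *ᵥ r) - sqNorm x = (M *ᵥ r) ⬝ᵥ (M *ᵥ r) - 2 * (x ⬝ᵥ (M *ᵥ r)) := by
    simp only [sqNorm, dotProduct, Finset.mul_sum, ← Finset.sum_sub_distrib]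
    refine Finset.sum_congr rfl fun i _ => ?_
    simp only [Pi.sub_apply]
    ring
  have e1 : (M * vecMulVec r r * Mᵀ).trace = (M *ᵥ r) ⬝ᵥ (M *ᵥ r) := by
    rw [mul_vecMulVec, vecMulVec_mul, vecMul_transpose, trace_vecMulVec]
  have e2 : (Mᵀ * vecMulVec x r).trace = x ⬝ᵥ (M *ᵥ r) := by
    rw [mul_vecMulVec, trace_vecMulVec, mulVec_transpose, dotProduct_mulVec]
  unfold basisObjective
  rw [← add_assoc, Matrix.mul_add M, Matrix.add_mul, trace_add, Matrix.mul_add Mᵀ, trace_add,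
    e1, e2, e]
  ring

lemma basisObjective_zero (M : Matrix (Fin p) (Fin q) ℝ) :
    basisObjective lam1 0 0 M = lam1 * sqFrob M := by
  simp [basisObjective, sqFrob, trace, Matrix.mul_apply, Finset.mul_sum, sq]

variable {d : ℕ → Fin p → ℝ} {r : ℕ → Fin q → ℝ} {s : ℕ → Fin p → ℝ}
  {A : ℕ → Matrix (Fin q) (Fin q) ℝ} {B L : ℕ → Matrix (Fin p) (Fin q) ℝ}

lemma IsRun.basisObjective_eq (h : IsRun G lam1 lam2 d r s A B L) (t : ℕ)
    (M : Matrix (Fin p) (Fin q) ℝ) :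
    basisObjective lam1 (A t) (B t) M
      = ridgeObjective lam1 (fun i => d i - s i) r t M
        - ∑ i ∈ Finset.range t, sqNorm (d i - s i) := by
  induction t with
  | zero => simp [h.A_zero, h.B_zero, basisObjective_zero, ridgeObjective]
  | succ t ih =>
    rw [h.A_succ, h.B_succ, basisObjective_add_vecMulVec, ih]
    simp only [ridgeObjective, Finset.sum_range_succ]
    ring

lemma IsRun.ridgeObjective_le (h : IsRun G lam1 lam2 d r s A B L) (t : ℕ)
    (M : Matrix (Fin p) (Fin q) ℝ) :
    ridgeObjective lam1 (fun i => d i - s i) r (t + 1) (L (t + 1))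
      ≤ ridgeObjective lam1 (fun i => d i - s i) r (t + 1) M := by
  have := h.update t M
  rw [h.basisObjective_eq, h.basisObjective_eq] at this
  linarith

lemma surrogate_eq (t : ℕ) (M : Matrix (Fin p) (Fin q) ℝ) :
    surrogate G lam1 lam2 d r s t M
      = 1 / (t : ℝ) * (1 / 2 * ridgeObjective lam1 (fun i => d i - s i) r t M
        + ∑ i ∈ Finset.range t, (lam1 / 2 * sqNorm (r i) + lam2 * groupNorm G (s i))) := by
  have : ∀ i, frameCost G lam1 lam2 (d i) M (r i) (s i)
      = 1 / 2 * sqNorm (d i - s i - M *ᵥ r i)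
        + (lam1 / 2 * sqNorm (r i) + lam2 * groupNorm G (s i)) := by
    intro i
    rw [frameCost, sub_right_comm, add_assoc]
  unfold surrogate ridgeObjective
  simp only [this, Finset.sum_add_distrib, ← Finset.mul_sum]
  rcases eq_or_ne (t : ℝ) 0 with ht | ht
  · simp [ht]
  · field_simp
    ring

lemma IsRun.surrogate_le (h : IsRun G lam1 lam2 d r s A B L) (t : ℕ)
    (M : Matrix (Fin p) (Fin q) ℝ) :
    surrogate G lam1 lam2 d r s (t + 1) (L (t + 1)) ≤ surrogate G lam1 lam2 d r s (t + 1) M := by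
  rw [surrogate_eq, surrogate_eq]
  have := h.ridgeObjective_le t M
  gcongr

lemma surrogate_nonneg (h1 : 0 < lam1) (h2 : 0 < lam2) (t : ℕ)
    (M : Matrix (Fin p) (Fin q) ℝ) : 0 ≤ surrogate G lam1 lam2 d r s t M := by
  have := Finset.sum_nonneg fun i (_ : i ∈ Finset.range t) =>
    frameCost_nonneg (G := G) h1 h2 (d i) M (r i) (s i)
  have := sqFrob_nonneg M
  unfold surrogate
  positivity

lemma IsRun.surrogate_succ_sub_le (h : IsRun G lam1 lam2 d r s A B L) (h1 : 0 < lam1)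
    (h2 : 0 < lam2) {t : ℕ} (ht : 0 < t) :
    surrogate G lam1 lam2 d r s (t + 1) (L (t + 1)) - surrogate G lam1 lam2 d r s t (L t)
      ≤ (optCost G lam1 lam2 (d t) (L t)
          - 1 / (t : ℝ) * ∑ i ∈ Finset.range t, optCost G lam1 lam2 (d i) (L t)) / (t + 1) := by
  have hle := h.surrogate_le t (L t)
  have hopt := optCost_eq_of_isMin h1 h2 (h.separation t)
  have hsum : ∑ i ∈ Finset.range t, optCost G lam1 lam2 (d i) (L t)
      ≤ ∑ i ∈ Finset.range t, frameCost G lam1 lam2 (d i) (L t) (r i) (s i) :=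
    Finset.sum_le_sum fun i _ => optCost_le h1 h2 _ _ _ _
  have hF := mul_nonneg h1.le (sqFrob_nonneg (L t))
  have ht' : (0 : ℝ) < t := by exact_mod_cast ht
  have e : surrogate G lam1 lam2 d r s (t + 1) (L t)
      = (t * surrogate G lam1 lam2 d r s t (L t) + optCost G lam1 lam2 (d t) (L t)) / (t + 1) := by
    rw [surrogate, surrogate, Finset.sum_range_succ, hopt]
    push_cast
    field_simp
    ring
  have hs : 1 / (t : ℝ) * ∑ i ∈ Finset.range t, optCost G lam1 lam2 (d i) (L t)
      ≤ surrogate G lam1 lam2 d r s t (L t) := by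
    rw [surrogate]
    have : 0 ≤ lam1 / (2 * (t : ℝ)) * sqFrob (L t) :=
      mul_nonneg (by positivity) (sqFrob_nonneg _)
    have := mul_le_mul_of_nonneg_left hsum (show 0 ≤ 1 / (t : ℝ) by positivity)
    linarith
  rw [e] at hle
  have e2 : (t * surrogate G lam1 lam2 d r s t (L t) + optCost G lam1 lam2 (d t) (L t)) / (t + 1)
      - surrogate G lam1 lam2 d r s t (L t)
      = (optCost G lam1 lam2 (d t) (L t) - surrogate G lam1 lam2 d r s t (L t)) / ((t : ℝ) + 1) := by
    field_simp
    ring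
  have : (optCost G lam1 lam2 (d t) (L t) - surrogate G lam1 lam2 d r s t (L t)) / ((t : ℝ) + 1)
      ≤ (optCost G lam1 lam2 (d t) (L t)
          - 1 / (t : ℝ) * ∑ i ∈ Finset.range t, optCost G lam1 lam2 (d i) (L t)) / (t + 1) := by
    gcongr
  linarith

lemma ridgeObjective_midpoint_le (x : ℕ → Fin p → ℝ) (r : ℕ → Fin q → ℝ)
    (t : ℕ) (M N : Matrix (Fin p) (Fin q) ℝ) :
    ridgeObjective lam1 x r t ((1 / 2 : ℝ) • (M + N)) + lam1 / 4 * sqFrob (M - N)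
      ≤ (ridgeObjective lam1 x r t M + ridgeObjective lam1 x r t N) / 2 := by
  have h : ∀ i ∈ Finset.range t, sqNorm (x i - ((1 / 2 : ℝ) • (M + N)) *ᵥ r i)
      ≤ (sqNorm (x i - M *ᵥ r i) + sqNorm (x i - N *ᵥ r i)) / 2 := by
    intro i _
    have e := sqNorm_midpoint (x i - M *ᵥ r i) (x i - N *ᵥ r i)
    have e2 : (1 / 2 : ℝ) • ((x i - M *ᵥ r i) + (x i - N *ᵥ r i))
        = x i - ((1 / 2 : ℝ) • (M + N)) *ᵥ r i := by
      rw [smul_mulVec, add_mulVec]; module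
    rw [e2] at e
    linarith [sqNorm_nonneg (x i - M *ᵥ r i - (x i - N *ᵥ r i))]
  have hs := Finset.sum_le_sum h
  rw [← Finset.sum_div, Finset.sum_add_distrib] at hs
  have hF := sqFrob_midpoint M N
  unfold ridgeObjective
  linear_combination hs + lam1 * hF

lemma tendsto_of_ridgeObjective_tendsto (h1 : 0 < lam1) {x : ℕ → Fin p → ℝ} {r : ℕ → Fin q → ℝ}
    {t : ℕ} {M : Matrix (Fin p) (Fin q) ℝ}
    (hmin : ∀ N, ridgeObjective lam1 x r t M ≤ ridgeObjective lam1 x r t N)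
    {z : ℕ → Matrix (Fin p) (Fin q) ℝ}
    (hz : Tendsto (fun n => ridgeObjective lam1 x r t (z n)) atTop
      (𝓝 (ridgeObjective lam1 x r t M))) :
    Tendsto z atTop (𝓝 M) := by
  have h0 : Tendsto (fun n => 2 / lam1 * (ridgeObjective lam1 x r t (z n)
      - ridgeObjective lam1 x r t M)) atTop (𝓝 0) := by
    simpa using (hz.sub_const (ridgeObjective lam1 x r t M)).const_mul (2 / lam1)
  have key : ∀ n, sqFrob (z n - M) ≤ 2 / lam1 * (ridgeObjective lam1 x r t (z n)
      - ridgeObjective lam1 x r t M) := by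
    intro n
    have a := ridgeObjective_midpoint_le (lam1 := lam1) x r t (z n) M
    have b := hmin ((1 / 2 : ℝ) • (z n + M))
    rw [div_mul_eq_mul_div, le_div_iff₀ h1]
    linarith
  have := (tendsto_zero_of_sqFrob (squeeze_zero (fun n => sqFrob_nonneg _) key h0)).add_const M
  simpa using this

end BasisUpdate

/-- The minimizer of a random continuous function is measurable if every minimizing sequence
converges to it. -/
lemma measurable_of_wellPosed_min {Ω Z : Type*} [MeasurableSpace Ω] [TopologicalSpace Z]
    [TopologicalSpace.PseudoMetrizableSpace Z] [TopologicalSpace.SeparableSpace Z]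
    [MeasurableSpace Z] [BorelSpace Z]
    {c : Ω → Z → ℝ} (hc_meas : ∀ z, Measurable fun ω => c ω z) (hc_cont : ∀ ω, Continuous (c ω))
    {x : Ω → Z} (hmin : ∀ ω z, c ω (x ω) ≤ c ω z)
    (hx : ∀ ω (z : ℕ → Z), Tendsto (fun n => c ω (z n)) atTop (𝓝 (c ω (x ω))) →
      Tendsto z atTop (𝓝 (x ω))) :
    Measurable x := by
  classical
  rcases isEmpty_or_nonempty Ω with hΩ | ⟨⟨ω₀⟩⟩
  · exact measurable_of_empty x
  have : Nonempty Z := ⟨x ω₀⟩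
  have hD := TopologicalSpace.denseRange_denseSeq Z
  set D := TopologicalSpace.denseSeq Z
  have hex : ∀ ω (ε : ℝ), 0 < ε → ∃ k, c ω (D k) < c ω (x ω) + ε := by
    intro ω ε hε
    have ho : IsOpen {z | c ω z < c ω (x ω) + ε} := isOpen_lt (hc_cont ω) continuous_const
    obtain ⟨k, hk⟩ := hD.exists_mem_open ho ⟨x ω, by simpa using hε⟩
    exact ⟨k, hk⟩
  have hbdd : ∀ ω, BddBelow (Set.range fun k => c ω (D k)) := fun ω =>
    ⟨c ω (x ω), by rintro _ ⟨k, rfl⟩; exact hmin ω _⟩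
  have hmin_meas : Measurable fun ω => c ω (x ω) := by
    have : (fun ω => c ω (x ω)) = fun ω => ⨅ k, c ω (D k) := by
      funext ω
      refine le_antisymm (le_ciInf fun k => hmin ω _) (le_of_forall_pos_le_add fun ε hε => ?_)
      obtain ⟨k, hk⟩ := hex ω ε hε
      exact (ciInf_le (hbdd ω) k).trans hk.le
    rw [this]
    exact Measurable.iInf fun k => hc_meas _
  have hex' : ∀ (n : ℕ) ω, ∃ k, c ω (D k) < c ω (x ω) + 1 / ((n : ℝ) + 1) := fun n ω =>
    hex ω _ (by positivity)
  refine measurable_of_tendsto_metrizable (f := fun n ω => D (Nat.find (hex' n ω))) (fun n => ?_) ?_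
  · refine (measurable_from_top (f := D)).comp (measurable_find (hex' n) fun k => ?_)
    exact measurableSet_lt (hc_meas _) (hmin_meas.add_const _)
  · rw [tendsto_pi_nhds]
    intro ω
    refine hx ω _ ?_
    have h1 : Tendsto (fun n : ℕ => c ω (x ω) + 1 / ((n : ℝ) + 1)) atTop (𝓝 (c ω (x ω))) := by
      simpa using tendsto_one_div_add_atTop_nhds_zero_nat.const_add (c ω (x ω))
    exact tendsto_of_tendsto_of_tendsto_of_le_of_le tendsto_const_nhds h1 (fun n => hmin ω _)
      fun n => (Nat.find_spec (hex' n ω)).le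

variable {p q : ℕ} {G : Finset (Finset (Fin p))} {lam1 lam2 : ℝ}

lemma measurable_frameCost :
    Measurable fun x : ((Fin p → ℝ) × (Fin p → Fin q → ℝ)) × (Fin q → ℝ) × (Fin p → ℝ) =>
      frameCost G lam1 lam2 x.1.1 (Matrix.of x.1.2) x.2.1 x.2.2 :=
  continuous_frameCost.measurable

lemma measurable_optCost (h1 : 0 < lam1) (h2 : 0 < lam2) :
    Measurable fun x : (Fin p → ℝ) × (Fin p → Fin q → ℝ) =>
      optCost G lam1 lam2 x.1 (Matrix.of x.2) := by
  refine UpperSemicontinuous.measurable ?_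
  have hc : ∀ z : (Fin q → ℝ) × (Fin p → ℝ),
      Continuous fun x : (Fin p → ℝ) × (Fin p → Fin q → ℝ) =>
        frameCost G lam1 lam2 x.1 (Matrix.of x.2) z.1 z.2 := by
    intro z
    have h := (continuous_frameCost (p := p) (q := q) (G := G) (lam1 := lam1) (lam2 := lam2)).comp
      ((continuous_id (X := (Fin p → ℝ) × (Fin p → Fin q → ℝ))).prodMk (continuous_const (y := z)))
    simpa only [Function.comp_def, id] using h
  refine upperSemicontinuous_ciInf (fun x => ?_) fun z => (hc z).upperSemicontinuous
  exact ⟨0, by rintro _ ⟨z, rfl⟩; exact frameCost_nonneg h1 h2 _ _ _ _⟩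

lemma measurable_ridgeObjective (t : ℕ) :
    Measurable fun x : ((ℕ → Fin p → ℝ) × (ℕ → Fin q → ℝ)) × (Fin p → Fin q → ℝ) =>
      ridgeObjective lam1 x.1.1 x.1.2 t (Matrix.of x.2) := by
  unfold ridgeObjective sqNorm sqFrob mulVec dotProduct
  simp only [Matrix.of_apply, Pi.sub_apply]
  fun_prop

lemma ridgeObjective_congr {x x' : ℕ → Fin p → ℝ} {r r' : ℕ → Fin q → ℝ} {t : ℕ}
    (hx : ∀ i < t, x i = x' i) (hr : ∀ i < t, r i = r' i) (M : Matrix (Fin p) (Fin q) ℝ) :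
    ridgeObjective lam1 x r t M = ridgeObjective lam1 x' r' t M := by
  unfold ridgeObjective
  congr 1
  refine Finset.sum_congr rfl fun i hi => ?_
  rw [hx i (Finset.mem_range.1 hi), hr i (Finset.mem_range.1 hi)]

lemma measurable_basis {Ω : Type*} [MeasurableSpace Ω] (h1 : 0 < lam1) (h2 : 0 < lam2)
    {d : ℕ → Ω → Fin p → ℝ} {r : ℕ → Ω → Fin q → ℝ} {s : ℕ → Ω → Fin p → ℝ}
    {A : ℕ → Ω → Matrix (Fin q) (Fin q) ℝ} {B L : ℕ → Ω → Matrix (Fin p) (Fin q) ℝ}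
    (hrun : ∀ ω, IsRun G lam1 lam2 (fun t => d t ω) (fun t => r t ω) (fun t => s t ω)
      (fun t => A t ω) (fun t => B t ω) (fun t => L t ω))
    (hL0 : Measurable fun ω => fun (i : Fin p) (j : Fin q) => L 0 ω i j) (n : ℕ)
    (hd : ∀ i < n, Measurable (d i)) :
    (∀ i < n, Measurable (r i) ∧ Measurable (s i)) ∧
      Measurable fun ω => fun (i : Fin p) (j : Fin q) => L n ω i j := by
  induction n with
  | zero => exact ⟨fun i hi => absurd hi (Nat.not_lt_zero i), hL0⟩
  | succ n ih =>
    obtain ⟨ihrs, ihL⟩ := ih fun i hi => hd i (hi.trans n.lt_succ_self)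
    have hmeas : ∀ z : (Fin q → ℝ) × (Fin p → ℝ),
        Measurable fun ω => frameCost G lam1 lam2 (d n ω) (L n ω) z.1 z.2 := by
      intro z
      have h := (measurable_frameCost (G := G) (lam1 := lam1) (lam2 := lam2)).comp
        (((hd n n.lt_succ_self).prodMk ihL).prodMk (measurable_const (a := z)))
      simp only [Function.comp_def] at h
      exact h
    have hcont : ∀ ω, Continuous fun z : (Fin q → ℝ) × (Fin p → ℝ) =>
        frameCost G lam1 lam2 (d n ω) (L n ω) z.1 z.2 := by
      intro ω
      have h := (continuous_frameCost (G := G) (lam1 := lam1) (lam2 := lam2)).comp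
        ((continuous_const (X := (Fin q → ℝ) × (Fin p → ℝ)) (y := (d n ω,
        (fun i j => L n ω i j : Fin p → Fin q → ℝ)))).prodMk continuous_id)
      simp only [Function.comp_def, id] at h
      exact h
    have hrs : Measurable fun ω => (r n ω, s n ω) :=
      measurable_of_wellPosed_min (Z := (Fin q → ℝ) × (Fin p → ℝ)) hmeas hcont
        (fun ω z => (hrun ω).separation n z.1 z.2)
        (fun ω _ hz => tendsto_of_frameCost_tendsto h1 h2 ((hrun ω).separation n) hz)
    have hrs' : ∀ i < n + 1, Measurable (r i) ∧ Measurable (s i) := by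
      intro i hi
      rcases Nat.lt_succ_iff_lt_or_eq.1 hi with hi | rfl
      · exact ihrs i hi
      · exact ⟨hrs.fst, hrs.snd⟩
    refine ⟨hrs', ?_⟩
    have hmeas' : ∀ M : Fin p → Fin q → ℝ, Measurable fun ω =>
        ridgeObjective lam1 (fun i => d i ω - s i ω) (fun i => r i ω) (n + 1) (Matrix.of M) := by
      intro M
      have hx : Measurable fun ω => ((fun i => if i < n + 1 then d i ω - s i ω else 0,
          fun i => if i < n + 1 then r i ω else 0) : (ℕ → Fin p → ℝ) × (ℕ → Fin q → ℝ)) := by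
        refine Measurable.prodMk (measurable_pi_iff.2 fun i => ?_) (measurable_pi_iff.2 fun i => ?_)
        · by_cases hi : i < n + 1
          · simpa only [hi, if_true] using! (hd i hi).sub (hrs' i hi).2
          · simp [hi]
        · by_cases hi : i < n + 1
          · simpa [hi] using (hrs' i hi).1
          · simp [hi]
      have h := (measurable_ridgeObjective (lam1 := lam1) (n + 1)).comp
        (hx.prodMk (measurable_const (a := M)))
      convert h using 1
      funext ω
      exact ridgeObjective_congr (fun i hi => by simp [hi]) (fun i hi => by simp [hi]) _
    have hcont' : ∀ ω, Continuous fun M : Fin p → Fin q → ℝ =>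
        ridgeObjective lam1 (fun i => d i ω - s i ω) (fun i => r i ω) (n + 1) (Matrix.of M) := by
      intro ω
      unfold ridgeObjective sqNorm sqFrob mulVec dotProduct
      simp only [Matrix.of_apply, Pi.sub_apply]
      fun_prop
    exact measurable_of_wellPosed_min (Z := Fin p → Fin q → ℝ) hmeas' hcont'
      (fun ω M => (hrun ω).ridgeObjective_le n M)
      (fun ω _ hz => tendsto_of_ridgeObjective_tendsto h1 ((hrun ω).ridgeObjective_le n) hz)

section Averages

lemma ae_summable_of_summable_integral {Ω : Type*} [MeasurableSpace Ω] {μ : Measure Ω} {f : ℕ → Ω → ℝ} (hf : ∀ n ω, 0 ≤ f n ω)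
    (hint : ∀ n, Integrable (f n) μ) (hsum : Summable fun n => ∫ ω, f n ω ∂μ) :
    ∀ᵐ ω ∂μ, Summable fun n => f n ω := by
  have hmeas : ∀ n, AEMeasurable (fun ω => ENNReal.ofReal (f n ω)) μ := fun n =>
    (hint n).aestronglyMeasurable.aemeasurable.ennreal_ofReal
  have hfin : ∫⁻ ω, ∑' n, ENNReal.ofReal (f n ω) ∂μ ≠ ⊤ := by
    rw [lintegral_tsum hmeas]
    have : ∀ n, ∫⁻ ω, ENNReal.ofReal (f n ω) ∂μ = ENNReal.ofReal (∫ ω, f n ω ∂μ) := fun n =>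
      (ofReal_integral_eq_lintegral_ofReal (hint n) (Eventually.of_forall (hf n))).symm
    simp only [this]
    exact hsum.tsum_ofReal_ne_top
  filter_upwards [ae_lt_top' (AEMeasurable.tsum hmeas) hfin] with ω hω
  have h := ENNReal.summable_toReal hω.ne
  simpa only [ENNReal.toReal_ofReal (hf _ _)] using h

variable {Ω : Type*} [MeasurableSpace Ω] {μ : Measure Ω} [IsProbabilityMeasure μ]

lemma integral_abs_sub_average_le {X : ℕ → Ω → ℝ} (hX : ∀ i, Measurable (X i))
    (hmem : ∀ i ω, X i ω ∈ Set.Icc (0 : ℝ) 1) (hind : Pairwise fun i j => IndepFun (X i) (X j) μ)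
    {m : ℝ} (hm : ∀ i, ∫ ω, X i ω ∂μ = m) {t : ℕ} (ht : 0 < t) :
    ∫ ω, |m - 1 / (t : ℝ) * ∑ i ∈ Finset.range t, X i ω| ∂μ ≤ 1 / √t := by
  have ht' : (0 : ℝ) < t := by exact_mod_cast ht
  have hLp : ∀ i, MemLp (X i) 2 μ := fun i =>
    MemLp.of_bound (hX i).aestronglyMeasurable 1 (Eventually.of_forall fun ω => by
      rw [Real.norm_eq_abs, abs_of_nonneg (hmem i ω).1]; exact (hmem i ω).2)
  have hLpS : MemLp (∑ i ∈ Finset.range t, X i) 2 μ := memLp_finsetSum' _ fun i _ => hLp i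
  have hvar : Var[∑ i ∈ Finset.range t, X i; μ] ≤ t := by
    rw [IndepFun.variance_sum (fun i _ => hLp i) fun i _ j _ hij => hind hij]
    calc ∑ i ∈ Finset.range t, Var[X i; μ] ≤ ∑ i ∈ Finset.range t, ((1 - 0) / 2 : ℝ) ^ 2 :=
          Finset.sum_le_sum fun i _ => variance_le_sq_of_bounded
            (Eventually.of_forall fun ω => hmem i ω) (hX i).aemeasurable
      _ ≤ t := by
          rw [Finset.sum_const, Finset.card_range, nsmul_eq_mul]
          nlinarith
  have hmean : ∫ ω, (∑ i ∈ Finset.range t, X i) ω ∂μ = t * m := by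
    simp only [Finset.sum_apply]
    rw [integral_finsetSum _ fun i _ => (hLp i).integrable (by norm_num)]
    simp [hm]
  rw [variance_eq_integral hLpS.aestronglyMeasurable.aemeasurable, hmean] at hvar
  have hint : Integrable (fun ω => ((∑ i ∈ Finset.range t, X i) ω - t * m) ^ 2) μ :=
    (hLpS.sub (memLp_const _)).integrable_sq
  set η : ℝ := √t
  have hη : 0 < η := Real.sqrt_pos.2 ht'
  have hη2 : η ^ 2 = t := Real.sq_sqrt ht'.le
  have hpt : ∀ ω, |m - 1 / (t : ℝ) * ∑ i ∈ Finset.range t, X i ω|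
      ≤ 1 / (2 * η) + 1 / (2 * η * t) * ((∑ i ∈ Finset.range t, X i) ω - t * m) ^ 2 := by
    intro ω
    rw [Finset.sum_apply]
    set S := ∑ i ∈ Finset.range t, X i ω
    have e : m - 1 / (t : ℝ) * S = -(S - t * m) / t := by field_simp; ring
    rw [e, abs_div, abs_neg, abs_of_pos ht']
    have h := sq_nonneg (|S - t * m| - η)
    have e2 : 1 / (2 * η) + 1 / (2 * η * t) * (S - t * m) ^ 2 - |S - t * m| / t
        = (|S - t * m| - η) ^ 2 / (2 * η * t) := by
      rw [← sq_abs (S - t * m)]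
      field_simp
      rw [← hη2]
      ring
    have : 0 ≤ (|S - t * m| - η) ^ 2 / (2 * η * t) := by positivity
    linarith
  calc ∫ ω, |m - 1 / (t : ℝ) * ∑ i ∈ Finset.range t, X i ω| ∂μ
      ≤ ∫ ω, (1 / (2 * η) + 1 / (2 * η * t) * ((∑ i ∈ Finset.range t, X i) ω - t * m) ^ 2) ∂μ :=
        integral_mono_of_nonneg (Eventually.of_forall fun _ => abs_nonneg _)
          ((integrable_const _).add (hint.const_mul _)) (Eventually.of_forall hpt)
    _ = 1 / (2 * η) + 1 / (2 * η * t) * ∫ ω, ((∑ i ∈ Finset.range t, X i) ω - t * m) ^ 2 ∂μ := by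
        rw [integral_add (integrable_const _) (hint.const_mul _), integral_const_mul]
        simp
    _ ≤ 1 / (2 * η) + 1 / (2 * η * t) * t := by gcongr
    _ = 1 / η := by field_simp; ring

end Averages

section Grid

variable {p : ℕ}

/-- The index of the cell of the grid of mesh `ε` that contains `y`. -/
noncomputable def gridCell (ε : ℝ) (y : Fin p → ℝ) : Fin p → ℤ := fun i => ⌊y i / ε⌋

/-- The corner of a cell of the grid of mesh `ε`. -/
noncomputable def gridPoint (ε : ℝ) (c : Fin p → ℤ) : Fin p → ℝ := fun i => ε * c i

/-- The cells of the grid of mesh `ε` that are needed to cover the ball of radius `C`. -/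
noncomputable def gridCells (p : ℕ) (C ε : ℝ) : Finset (Fin p → ℤ) :=
  Fintype.piFinset fun _ => Finset.Icc (-((⌈C / ε⌉₊ : ℤ) + 1)) ((⌈C / ε⌉₊ : ℤ) + 1)

/-- The indicator function of a cell of the grid. -/
noncomputable def cellIndicator (ε : ℝ) (c : Fin p → ℤ) (y : Fin p → ℝ) : ℝ :=
  if gridCell ε y = c then 1 else 0

lemma measurable_gridCell (ε : ℝ) : Measurable (gridCell (p := p) ε) :=
  measurable_pi_iff.2 fun i => Int.measurable_floor.comp (Measurable.div_const (f := fun y : Fin p → ℝ => y i) (measurable_pi_apply i) ε)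

lemma measurable_cellIndicator (ε : ℝ) (c : Fin p → ℤ) : Measurable (cellIndicator ε c) :=
  Measurable.ite (measurable_gridCell ε (measurableSet_singleton c)) measurable_const
    measurable_const

lemma cellIndicator_mem_Icc (ε : ℝ) (c : Fin p → ℤ) (y : Fin p → ℝ) :
    cellIndicator ε c y ∈ Set.Icc (0 : ℝ) 1 := by
  unfold cellIndicator
  split_ifs <;> simp

lemma gridCell_mem_gridCells {C ε : ℝ} (hε : 0 < ε) {y : Fin p → ℝ} (hy : ‖y‖ ≤ C) :
    gridCell ε y ∈ gridCells p C ε := by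
  refine Fintype.mem_piFinset.2 fun i => Finset.mem_Icc.2 ?_
  have h := abs_le.1 ((norm_le_pi_norm y i).trans hy)
  have hc := Nat.le_ceil (C / ε)
  have h1 : y i / ε ≤ C / ε := by gcongr; exact h.2
  have h2 : -(C / ε) ≤ y i / ε := by rw [← neg_div]; gcongr; exact h.1
  constructor
  · refine Int.le_floor.2 ?_
    push_cast
    linarith
  · have : (⌊y i / ε⌋ : ℝ) ≤ ((⌈C / ε⌉₊ : ℤ) + 1 : ℤ) := by
      push_cast
      linarith [Int.floor_le (y i / ε)]
    exact_mod_cast this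

lemma norm_sub_gridPoint_gridCell_le {ε : ℝ} (hε : 0 < ε) (y : Fin p → ℝ) :
    ‖y - gridPoint ε (gridCell ε y)‖ ≤ ε := by
  refine (pi_norm_le_iff_of_nonneg hε.le).2 fun i => ?_
  have h1 := Int.floor_le (y i / ε)
  have h2 := (Int.lt_floor_add_one (y i / ε)).le
  rw [le_div_iff₀ hε] at h1
  rw [div_le_iff₀ hε] at h2
  simp only [gridPoint, gridCell, Pi.sub_apply, Real.norm_eq_abs]
  rw [abs_le]
  constructor <;> linarith

lemma norm_gridPoint_le {C ε : ℝ} (hC : 0 ≤ C) (hε : 0 < ε) (hε1 : ε ≤ 1) {c : Fin p → ℤ}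
    (hc : c ∈ gridCells p C ε) : ‖gridPoint ε c‖ ≤ C + 2 := by
  refine (pi_norm_le_iff_of_nonneg (by positivity)).2 fun i => ?_
  have h := Finset.mem_Icc.1 (Fintype.mem_piFinset.1 hc i)
  have h1 : -((⌈C / ε⌉₊ : ℝ) + 1) ≤ c i := by exact_mod_cast h.1
  have h2 : (c i : ℝ) ≤ (⌈C / ε⌉₊ : ℝ) + 1 := by exact_mod_cast h.2
  have h3 := (Nat.ceil_lt_add_one (show 0 ≤ C / ε by positivity)).le
  have h4 : |(c i : ℝ)| ≤ C / ε + 2 := by rw [abs_le]; constructor <;> linarith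
  simp only [gridPoint, Real.norm_eq_abs, abs_mul, abs_of_pos hε]
  calc ε * |(c i : ℝ)| ≤ ε * (C / ε + 2) := by gcongr
    _ = C + 2 * ε := by field_simp
    _ ≤ C + 2 := by linarith

lemma card_gridCells_le {C ε : ℝ} (hC : 0 ≤ C) (hε : 0 < ε) (hε1 : ε ≤ 1) :
    ((gridCells p C ε).card : ℝ) ≤ ((2 * C + 5) / ε) ^ p := by
  have h3 := (Nat.ceil_lt_add_one (show 0 ≤ C / ε by positivity)).le
  have hcard : (gridCells p C ε).card = (2 * ⌈C / ε⌉₊ + 3) ^ p := by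
    simp only [gridCells, Fintype.card_piFinset, Int.card_Icc, Finset.prod_const,
      Finset.card_univ, Fintype.card_fin]
    congr 1
    omega
  rw [hcard]
  push_cast
  gcongr
  rw [add_div, mul_div_assoc]
  have : 5 ≤ 5 / ε := by rw [le_div_iff₀ hε]; linarith
  linarith

lemma sum_mul_cellIndicator {C ε : ℝ} (hε : 0 < ε) {y : Fin p → ℝ} (hy : ‖y‖ ≤ C)
    (w : (Fin p → ℤ) → ℝ) :
    ∑ c ∈ gridCells p C ε, w c * cellIndicator ε c y = w (gridCell ε y) := by
  simp [cellIndicator, gridCell_mem_gridCells hε hy]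

end Grid

section UniformLaw

variable {Ω : Type*} [MeasurableSpace Ω] {μ : Measure Ω} [IsProbabilityMeasure μ] {p : ℕ}

/-- Measurable functions that are bounded by `M` and vary by at most `K ε` at scale `ε ≤ 1` on
the ball of radius `R`. -/
structure IsTame (R M K : ℝ) (ψ : (Fin p → ℝ) → ℝ) : Prop where
  measurable : Measurable ψ
  bound : ∀ y, ‖y‖ ≤ R → |ψ y| ≤ M
  variation : ∀ y y' ε, ‖y‖ ≤ R → ‖y'‖ ≤ R → 0 < ε → ε ≤ 1 → ‖y - y'‖ ≤ ε →
    |ψ y - ψ y'| ≤ K * ε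

/-- A bound for the deviation between the law `ν` and the empirical law of `d 0, …, d (t - 1)`,
uniformly over tame functions. -/
noncomputable def gridDeviation (ν : Measure (Fin p → ℝ)) (C M K ε : ℝ) (d : ℕ → Fin p → ℝ)
    (t : ℕ) : ℝ :=
  2 * (K * ε) + M * ∑ c ∈ gridCells p C ε,
    |∫ y, cellIndicator ε c y ∂ν - 1 / (t : ℝ) * ∑ i ∈ Finset.range t, cellIndicator ε c (d i)|

lemma IsTame.abs_integral_sub_average_le {ν : Measure (Fin p → ℝ)} [IsProbabilityMeasure ν]
    {C M K ε : ℝ} (hC : 0 ≤ C) (hε : 0 < ε) (hε1 : ε ≤ 1)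
    (hν : ∀ᵐ y ∂ν, ‖y‖ ≤ C) {d : ℕ → Fin p → ℝ} (hd : ∀ i, ‖d i‖ ≤ C) {t : ℕ} (ht : 0 < t)
    {ψ : (Fin p → ℝ) → ℝ} (hψ : IsTame (C + 2) M K ψ) :
    |∫ y, ψ y ∂ν - 1 / (t : ℝ) * ∑ i ∈ Finset.range t, ψ (d i)|
      ≤ gridDeviation ν C M K ε d t := by
  have ht' : (0 : ℝ) < t := by exact_mod_cast ht
  set S := gridCells p C ε with hS
  set h : (Fin p → ℝ) → ℝ := fun y => ∑ c ∈ S, ψ (gridPoint ε c) * cellIndicator ε c y with hh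
  have happrox : ∀ y, ‖y‖ ≤ C → |ψ y - h y| ≤ K * ε := by
    intro y hy
    simp only [hh, hS, sum_mul_cellIndicator hε hy fun c => ψ (gridPoint ε c)]
    exact hψ.variation _ _ _ (hy.trans (by linarith))
      (norm_gridPoint_le hC hε hε1 (gridCell_mem_gridCells hε hy)) hε hε1
      (norm_sub_gridPoint_gridCell_le hε y)
  have hcint : ∀ c, Integrable (cellIndicator ε c) ν := fun c =>
    Integrable.of_bound (measurable_cellIndicator ε c).aestronglyMeasurable 1
      (Eventually.of_forall fun y => by
        rw [Real.norm_eq_abs, abs_of_nonneg (cellIndicator_mem_Icc ε c y).1]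
        exact (cellIndicator_mem_Icc ε c y).2)
  have hhint : Integrable h ν := integrable_finsetSum _ fun c _ => (hcint c).const_mul _
  have hψint : Integrable ψ ν :=
    Integrable.of_bound hψ.measurable.aestronglyMeasurable M (by
      filter_upwards [hν] with y hy using hψ.bound y (hy.trans (by linarith)))
  have hI : |∫ y, ψ y ∂ν - ∫ y, h y ∂ν| ≤ K * ε := by
    rw [← integral_sub hψint hhint, ← Real.norm_eq_abs]
    refine (norm_integral_le_of_norm_le_const (C := K * ε) ?_).trans (by simp)
    filter_upwards [hν] with y hy using happrox y hy
  have hE : |1 / (t : ℝ) * ∑ i ∈ Finset.range t, h (d i)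
      - 1 / (t : ℝ) * ∑ i ∈ Finset.range t, ψ (d i)| ≤ K * ε := by
    rw [← mul_sub, ← Finset.sum_sub_distrib, abs_mul, abs_of_pos (by positivity)]
    calc 1 / (t : ℝ) * |∑ i ∈ Finset.range t, (h (d i) - ψ (d i))|
        ≤ 1 / (t : ℝ) * ∑ i ∈ Finset.range t, K * ε := by
          gcongr
          refine (Finset.abs_sum_le_sum_abs _ _).trans (Finset.sum_le_sum fun i _ => ?_)
          rw [abs_sub_comm]
          exact happrox _ (hd i)
      _ = K * ε := by simp; field_simp
  have hM : |∫ y, h y ∂ν - 1 / (t : ℝ) * ∑ i ∈ Finset.range t, h (d i)|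
      ≤ M * ∑ c ∈ S, |∫ y, cellIndicator ε c y ∂ν
        - 1 / (t : ℝ) * ∑ i ∈ Finset.range t, cellIndicator ε c (d i)| := by
    have e1 : ∫ y, h y ∂ν = ∑ c ∈ S, ψ (gridPoint ε c) * ∫ y, cellIndicator ε c y ∂ν := by
      rw [hh, integral_finsetSum _ fun c _ => (hcint c).const_mul _]
      simp only [integral_const_mul]
    have e2 : 1 / (t : ℝ) * ∑ i ∈ Finset.range t, h (d i)
        = ∑ c ∈ S, ψ (gridPoint ε c)
          * (1 / (t : ℝ) * ∑ i ∈ Finset.range t, cellIndicator ε c (d i)) := by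
      simp only [hh]
      rw [Finset.sum_comm, Finset.mul_sum]
      refine Finset.sum_congr rfl fun c _ => ?_
      rw [← Finset.mul_sum]
      ring
    rw [e1, e2, ← Finset.sum_sub_distrib, Finset.mul_sum]
    refine (Finset.abs_sum_le_sum_abs _ _).trans (Finset.sum_le_sum fun c hc => ?_)
    rw [← mul_sub, abs_mul]
    gcongr
    exact hψ.bound _ (norm_gridPoint_le hC hε hε1 hc)
  unfold gridDeviation
  rw [← hS]
  have t1 := abs_sub_le (∫ y, ψ y ∂ν) (∫ y, h y ∂ν) (1 / (t : ℝ) * ∑ i ∈ Finset.range t, ψ (d i))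
  have t2 := abs_sub_le (∫ y, h y ∂ν) (1 / (t : ℝ) * ∑ i ∈ Finset.range t, h (d i))
    (1 / (t : ℝ) * ∑ i ∈ Finset.range t, ψ (d i))
  linarith

lemma integrable_gridDeviation (ν : Measure (Fin p → ℝ)) {C M K ε : ℝ}
    {d : ℕ → Ω → Fin p → ℝ} (hd : ∀ i, Measurable (d i)) (t : ℕ) :
    Integrable (fun ω => gridDeviation ν C M K ε (fun i => d i ω) t) μ := by
  unfold gridDeviation
  refine (integrable_const _).add ((integrable_finsetSum _ fun c _ => ?_).const_mul _)
  refine ((integrable_const _).sub ((integrable_finsetSum _ fun i _ => ?_).const_mul _)).abs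
  exact Integrable.of_bound
    ((measurable_cellIndicator ε c).comp (hd i)).aestronglyMeasurable 1
      (Eventually.of_forall fun ω => by
        have := cellIndicator_mem_Icc ε c (d i ω)
        rw [Real.norm_eq_abs, abs_of_nonneg this.1]
        exact this.2)

lemma integral_gridDeviation_le {C M K ε : ℝ} (hC : 0 ≤ C) (hM : 0 ≤ M)
    (hε : 0 < ε) (hε1 : ε ≤ 1) {d : ℕ → Ω → Fin p → ℝ} (hd : ∀ i, Measurable (d i))
    (hind : iIndepFun d μ) (hident : ∀ t, IdentDistrib (d t) (d 0) μ μ) {t : ℕ} (ht : 0 < t) :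
    ∫ ω, gridDeviation (μ.map (d 0)) C M K ε (fun i => d i ω) t ∂μ
      ≤ 2 * (K * ε) + M * (((2 * C + 5) / ε) ^ p * (1 / √t)) := by
  have hXmeas : ∀ c i, Measurable fun ω => cellIndicator ε c (d i ω) := fun c i =>
    (measurable_cellIndicator ε c).comp (hd i)
  have hcell : ∀ c : Fin p → ℤ, ∫ ω, |∫ y, cellIndicator ε c y ∂(μ.map (d 0))
      - 1 / (t : ℝ) * ∑ i ∈ Finset.range t, cellIndicator ε c (d i ω)| ∂μ ≤ 1 / √t := by
    intro c
    refine integral_abs_sub_average_le (X := fun i ω => cellIndicator ε c (d i ω)) (hXmeas c)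
      (fun i ω => cellIndicator_mem_Icc ε c (d i ω)) (fun i j hij => ?_) (fun i => ?_) ht
    · exact (hind.indepFun hij).comp (measurable_cellIndicator ε c) (measurable_cellIndicator ε c)
    · rw [integral_map (hd 0).aemeasurable (measurable_cellIndicator ε c).aestronglyMeasurable]
      exact ((hident i).comp (measurable_cellIndicator ε c)).integral_eq
  have hint : ∀ c : Fin p → ℤ, Integrable (fun ω => |∫ y, cellIndicator ε c y ∂(μ.map (d 0))
      - 1 / (t : ℝ) * ∑ i ∈ Finset.range t, cellIndicator ε c (d i ω)|) μ := by
    intro c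
    refine ((integrable_const _).sub ((integrable_finsetSum _ fun i _ => ?_).const_mul _)).abs
    exact Integrable.of_bound (hXmeas c i).aestronglyMeasurable 1
        (Eventually.of_forall fun ω => by
          have := cellIndicator_mem_Icc ε c (d i ω)
          rw [Real.norm_eq_abs, abs_of_nonneg this.1]
          exact this.2)
  unfold gridDeviation
  rw [integral_add (integrable_const _) ((integrable_finsetSum _ fun c _ => hint c).const_mul _),
    integral_const_mul M, integral_finsetSum _ fun c _ => hint c]
  have hs : ∑ c ∈ gridCells p C ε, ∫ ω, |∫ y, cellIndicator ε c y ∂(μ.map (d 0))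
      - 1 / (t : ℝ) * ∑ i ∈ Finset.range t, cellIndicator ε c (d i ω)| ∂μ
      ≤ ((2 * C + 5) / ε) ^ p * (1 / √t) := by
    refine (Finset.sum_le_sum fun c _ => hcell c).trans ?_
    rw [Finset.sum_const, nsmul_eq_mul]
    gcongr
    exact card_gridCells_le hC hε hε1
  simp only [integral_const, probReal_univ, smul_eq_mul, one_mul]
  gcongr

/-- A uniform law of large numbers over tame functions, with a rate that is summable against
`1 / t`. -/
theorem exists_summable_uniform_deviation {C M K : ℝ} (hC : 0 ≤ C) (hM : 0 ≤ M) (hK : 0 ≤ K)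
    {d : ℕ → Ω → Fin p → ℝ} (hd : ∀ i, Measurable (d i)) (hind : iIndepFun d μ)
    (hident : ∀ t, IdentDistrib (d t) (d 0) μ μ) (hbdd : ∀ t, ∀ᵐ ω ∂μ, ‖d t ω‖ ≤ C) :
    ∃ W : ℕ → Ω → ℝ, (∀ t ω, 0 ≤ W t ω) ∧
      (∀ᵐ ω ∂μ, Summable fun t : ℕ => W t ω / ((t : ℝ) + 1)) ∧
      ∀ᵐ ω ∂μ, ∀ t : ℕ, 0 < t → ∀ ψ : (Fin p → ℝ) → ℝ, IsTame (C + 2) M K ψ →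
        |∫ y, ψ y ∂(μ.map (d 0)) - 1 / (t : ℝ) * ∑ i ∈ Finset.range t, ψ (d i ω)| ≤ W t ω := by
  have : IsProbabilityMeasure (μ.map (d 0)) := Measure.isProbabilityMeasure_map (hd 0).aemeasurable
  set a : ℝ := 1 / (2 * ((p : ℝ) + 1)) with ha
  have ha0 : 0 < a := by positivity
  set ε : ℕ → ℝ := fun t => (t : ℝ) ^ (-a) with hεdef
  have hεpos : ∀ t : ℕ, 0 < t → 0 < ε t := fun t ht => Real.rpow_pos_of_pos (by exact_mod_cast ht) _
  have hεle : ∀ t : ℕ, 0 < t → ε t ≤ 1 := fun t ht =>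
    Real.rpow_le_one_of_one_le_of_nonpos (by exact_mod_cast ht) (by linarith)
  have hεnonneg : ∀ t, 0 ≤ ε t := fun t => Real.rpow_nonneg (Nat.cast_nonneg t) _
  have hnonneg : ∀ t ω, 0 ≤ gridDeviation (μ.map (d 0)) C M K (ε t) (fun i => d i ω) t := by
    intro t ω
    have := hεnonneg t
    unfold gridDeviation
    have := Finset.sum_nonneg fun c (_ : c ∈ gridCells p C (ε t)) =>
      abs_nonneg (∫ y, cellIndicator (ε t) c y ∂(μ.map (d 0))
        - 1 / (t : ℝ) * ∑ i ∈ Finset.range t, cellIndicator (ε t) c (d i ω))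
    positivity
  refine ⟨fun t ω => gridDeviation (μ.map (d 0)) C M K (ε t) (fun i => d i ω) t, hnonneg, ?_, ?_⟩
  · refine ae_summable_of_summable_integral
      (fun t ω => div_nonneg (hnonneg t ω) (by positivity)) (fun t => ?_) ?_
    · exact (integrable_gridDeviation _ hd t).div_const _
    · have hroot : ∀ t : ℕ, ε t ^ (p + 1) = 1 / √t := by
        intro t
        simp only [hεdef]
        rw [← Real.rpow_natCast, ← Real.rpow_mul (Nat.cast_nonneg t), Real.sqrt_eq_rpow, one_div,
          ← Real.rpow_neg (Nat.cast_nonneg t)]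
        congr 1
        rw [ha]
        push_cast
        field_simp
      have hps : Summable fun t : ℕ =>
          (2 * K + M * (2 * C + 5) ^ p) * (1 / (t : ℝ) ^ (1 + a)) :=
        (Real.summable_one_div_nat_rpow.2 (by linarith)).mul_left _
      refine Summable.of_norm_bounded_eventually_nat hps ?_
      filter_upwards [eventually_gt_atTop 0] with t ht
      have ht' : (0 : ℝ) < t := by exact_mod_cast ht
      have hεt := hεpos t ht
      have hnn : 0 ≤ ∫ ω, gridDeviation (μ.map (d 0)) C M K (ε t) (fun i => d i ω) t ∂μ :=
        integral_nonneg fun ω => hnonneg t ω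
      rw [integral_div, Real.norm_eq_abs, abs_of_nonneg (by positivity)]
      have hle := integral_gridDeviation_le (K := K) hC hM hεt (hεle t ht) hd hind hident ht
      rw [← hroot t] at hle
      have e : ((2 * C + 5) / ε t) ^ p * ε t ^ (p + 1) = (2 * C + 5) ^ p * ε t := by
        rw [div_pow, pow_succ]
        field_simp
      rw [e] at hle
      have e' : 1 / (t : ℝ) ^ (1 + a) = ε t / t := by
        simp only [hεdef]
        rw [Real.rpow_add ht', Real.rpow_neg ht'.le, Real.rpow_one]
        field_simp
      rw [e', div_le_iff₀ (by positivity)]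
      have : ε t ≤ ε t / t * (t + 1) := by
        rw [div_mul_eq_mul_div, le_div_iff₀ ht']
        nlinarith
      calc _ ≤ _ := hle
        _ = (2 * K + M * (2 * C + 5) ^ p) * ε t := by ring
        _ ≤ (2 * K + M * (2 * C + 5) ^ p) * (ε t / t * (t + 1)) := by gcongr
        _ = _ := by ring
  · have hall : ∀ᵐ ω ∂μ, ∀ i, ‖d i ω‖ ≤ C := ae_all_iff.2 hbdd
    have hν : ∀ᵐ y ∂(μ.map (d 0)), ‖y‖ ≤ C :=
      (ae_map_iff (hd 0).aemeasurable (measurableSet_le measurable_norm measurable_const)).2 (hbdd 0)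
    filter_upwards [hall] with ω hω t ht ψ hψ
    exact hψ.abs_integral_sub_average_le hC (hεpos t ht) (hεle t ht) hν hω ht

end UniformLaw

section Independence

variable {Ω : Type*} [MeasurableSpace Ω] {μ : Measure Ω} [IsProbabilityMeasure μ]

lemma indepFun_prodMk_left {α β γ : Type*} [MeasurableSpace α] [MeasurableSpace β]
    [MeasurableSpace γ] {X : Ω → α} {Y : Ω → β} {W : Ω → γ} (hX : Measurable X)
    (hY : Measurable Y) (hW : Measurable W) (h : IndepFun X (fun ω => (Y ω, W ω)) μ)
    (hYW : IndepFun Y W μ) : IndepFun (fun ω => (X ω, Y ω)) W μ := by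
  have h1 := (indepFun_iff_map_prod_eq_prod_map_map hX.aemeasurable
    (hY.prodMk hW).aemeasurable).1 h
  have h2 := (indepFun_iff_map_prod_eq_prod_map_map hY.aemeasurable hW.aemeasurable).1 hYW
  have h3 := (indepFun_iff_map_prod_eq_prod_map_map hX.aemeasurable hY.aemeasurable).1
    (h.comp measurable_id measurable_fst)
  have : IsProbabilityMeasure (μ.map X) := Measure.isProbabilityMeasure_map hX.aemeasurable
  have : IsProbabilityMeasure (μ.map Y) := Measure.isProbabilityMeasure_map hY.aemeasurable
  have : IsProbabilityMeasure (μ.map W) := Measure.isProbabilityMeasure_map hW.aemeasurable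
  rw [indepFun_iff_map_prod_eq_prod_map_map (hX.prodMk hY).aemeasurable hW.aemeasurable]
  have h3' : μ.map (fun ω => (X ω, Y ω)) = (μ.map X).prod (μ.map Y) := h3
  rw [h3']
  apply (MeasurableEquiv.prodAssoc (α := α) (β := β) (γ := γ)).map_measurableEquiv_injective
  rw [MeasureTheory.Measure.prodAssoc_prod, ← h2, ← h1,
    Measure.map_map (MeasurableEquiv.measurable _) ((hX.prodMk hY).prodMk hW)]
  rfl

lemma integral_mul_of_indepFun {E Y : Type*} [MeasurableSpace E] [MeasurableSpace Y]
    {ζ : Ω → ℝ} {ℓ : Ω → E} {d : Ω → Y} (hζ : Measurable ζ) (hℓ : Measurable ℓ)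
    (hd : Measurable d) {b : ℝ} (hb : ∀ ω, |ζ ω| ≤ b)
    (hind : IndepFun (fun ω => (ζ ω, ℓ ω)) d μ) {φ : E × Y → ℝ} (hφ : Measurable φ) {M : ℝ}
    (hM : ∀ x, |φ x| ≤ M) :
    ∫ ω, ζ ω * φ (ℓ ω, d ω) ∂μ = ∫ ω, ζ ω * ∫ y, φ (ℓ ω, y) ∂(μ.map d) ∂μ := by
  have : IsProbabilityMeasure (μ.map d) := Measure.isProbabilityMeasure_map hd.aemeasurable
  have : IsProbabilityMeasure (μ.map fun ω => (ζ ω, ℓ ω)) :=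
    Measure.isProbabilityMeasure_map (hζ.prodMk hℓ).aemeasurable
  have hlaw := (indepFun_iff_map_prod_eq_prod_map_map (hζ.prodMk hℓ).aemeasurable
    hd.aemeasurable).1 hind
  set F : (ℝ × E) × Y → ℝ := fun x => x.1.1 * φ (x.1.2, x.2) with hF
  have hFm : Measurable F := by fun_prop
  have hT : Measurable fun ω => ((ζ ω, ℓ ω), d ω) := (hζ.prodMk hℓ).prodMk hd
  have hint : Integrable F ((μ.map fun ω => (ζ ω, ℓ ω)).prod (μ.map d)) := by
    rw [← hlaw, integrable_map_measure hFm.aestronglyMeasurable hT.aemeasurable]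
    refine Integrable.of_bound (hFm.comp hT).aestronglyMeasurable (b * M)
      (Eventually.of_forall fun ω => ?_)
    simp only [hF, Function.comp_apply, norm_mul, Real.norm_eq_abs]
    exact mul_le_mul (hb ω) (hM _) (abs_nonneg _) ((abs_nonneg _).trans (hb ω))
  have e1 : ∫ ω, ζ ω * φ (ℓ ω, d ω) ∂μ
      = ∫ x, F x ∂(μ.map fun ω => ((ζ ω, ℓ ω), d ω)) := by
    rw [integral_map hT.aemeasurable hFm.aestronglyMeasurable]
  rw [e1, hlaw, integral_prod _ hint, integral_map (hζ.prodMk hℓ).aemeasurable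
    hFm.stronglyMeasurable.integral_prod_right'.aestronglyMeasurable]
  simp only [hF, integral_const_mul]

end Independence

section Martingale

variable {Ω : Type*} [mΩ : MeasurableSpace Ω] {μ : Measure Ω} [IsProbabilityMeasure μ]

/-- A series of bounded martingale differences with square summable bounds converges almost
surely. -/
theorem ae_tendsto_sum_of_orthogonal {ℱ : Filtration ℕ mΩ} {ξ : ℕ → Ω → ℝ} {b : ℕ → ℝ}
    (hξ : ∀ n, Measurable[ℱ (n + 1)] (ξ n)) (hb : ∀ n ω, |ξ n ω| ≤ b n)
    (hsum : Summable fun n => b n ^ 2)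
    (horth : ∀ n (ζ : Ω → ℝ), Measurable[ℱ n] ζ → (∃ c, ∀ ω, |ζ ω| ≤ c) →
      ∫ ω, ζ ω * ξ n ω ∂μ = 0) :
    ∀ᵐ ω ∂μ, ∃ l, Tendsto (fun n => ∑ t ∈ Finset.range n, ξ t ω) atTop (𝓝 l) := by
  set S : ℕ → Ω → ℝ := fun n ω => ∑ t ∈ Finset.range n, ξ t ω with hS
  have hSm : ∀ n, Measurable[ℱ n] (S n) := fun n =>
    Finset.measurable_sum _ fun t ht =>
      (hξ t).mono (ℱ.mono (Nat.succ_le_of_lt (Finset.mem_range.1 ht))) le_rfl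
  have hSm' : ∀ n, Measurable (S n) := fun n => (hSm n).mono (ℱ.le n) le_rfl
  have hξm : ∀ n, Measurable (ξ n) := fun n => (hξ n).mono (ℱ.le _) le_rfl
  have hSb : ∀ n ω, |S n ω| ≤ ∑ t ∈ Finset.range n, b t := fun n ω =>
    (Finset.abs_sum_le_sum_abs _ _).trans (Finset.sum_le_sum fun t _ => hb t ω)
  have hSi : ∀ n, Integrable (S n) μ := fun n =>
    Integrable.of_bound (hSm' n).aestronglyMeasurable _ (Eventually.of_forall (hSb n))
  have hξi : ∀ n, Integrable (ξ n) μ := fun n =>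
    Integrable.of_bound (hξm n).aestronglyMeasurable _ (Eventually.of_forall (hb n))
  have hsucc : ∀ n ω, S (n + 1) ω = S n ω + ξ n ω := fun n ω => Finset.sum_range_succ _ _
  have hmart : Martingale S ℱ μ := by
    refine martingale_of_setIntegral_eq_succ (fun n => (hSm n).stronglyMeasurable) hSi ?_
    intro n s hs
    have h0 := horth n (s.indicator fun _ => 1) (measurable_const.indicator hs)
      ⟨1, fun ω => by by_cases h : ω ∈ s <;> simp [h]⟩
    have h1 : ∫ ω in s, ξ n ω ∂μ = 0 := by
      rw [← integral_indicator (ℱ.le n s hs), ← h0]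
      congr 1
      funext ω
      by_cases h : ω ∈ s <;> simp [h]
    simp only [hsucc]
    rw [integral_add (hSi n).integrableOn (hξi n).integrableOn, h1, add_zero]
  have hsq : ∀ {f : Ω → ℝ} {c : ℝ}, Measurable f → (∀ ω, |f ω| ≤ c) →
      Integrable (fun ω => f ω ^ 2) μ := fun {f c} hf hc =>
    Integrable.of_bound (hf.pow_const 2).aestronglyMeasurable (c ^ 2)
      (Eventually.of_forall fun ω => by
        rw [Real.norm_eq_abs, abs_of_nonneg (sq_nonneg _), ← sq_abs]
        exact pow_le_pow_left₀ (abs_nonneg _) (hc ω) 2)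
  have hL2 : ∀ n, ∫ ω, S n ω ^ 2 ∂μ ≤ ∑ t ∈ Finset.range n, b t ^ 2 := by
    intro n
    induction n with
    | zero => simp [hS]
    | succ n ih =>
      have hcross : Integrable (fun ω => S n ω * ξ n ω) μ :=
        Integrable.of_bound ((hSm' n).mul (hξm n)).aestronglyMeasurable
          ((∑ t ∈ Finset.range n, b t) * b n) (Eventually.of_forall fun ω => by
            rw [norm_mul]
            exact mul_le_mul (hSb n ω) (hb n ω) (norm_nonneg _) ((abs_nonneg _).trans (hSb n ω)))
      have e : ∀ ω, S (n + 1) ω ^ 2 = S n ω ^ 2 + 2 * (S n ω * ξ n ω) + ξ n ω ^ 2 := fun ω => by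
        rw [hsucc]; ring
      have hlast : ∫ ω, ξ n ω ^ 2 ∂μ ≤ b n ^ 2 := by
        calc ∫ ω, ξ n ω ^ 2 ∂μ ≤ ∫ _, b n ^ 2 ∂μ :=
              integral_mono (hsq (hξm n) (hb n)) (integrable_const _) fun ω => by
                change ξ n ω ^ 2 ≤ b n ^ 2
                rw [← sq_abs]
                exact pow_le_pow_left₀ (abs_nonneg _) (hb n ω) 2
          _ = b n ^ 2 := by simp
      have hadd : Integrable (fun ω => S n ω ^ 2 + 2 * (S n ω * ξ n ω)) μ :=
        (hsq (hSm' n) (hSb n)).add (hcross.const_mul 2)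
      simp only [e]
      rw [integral_add hadd (hsq (hξm n) (hb n)),
        integral_add (hsq (hSm' n) (hSb n)) (hcross.const_mul 2), integral_const_mul,
        horth n (S n) (hSm n) ⟨_, hSb n⟩, Finset.sum_range_succ]
      linarith
  have hL1 : ∀ n, eLpNorm (S n) 1 μ ≤ ((1 + ∑' t, b t ^ 2).toNNReal : ENNReal) := by
    intro n
    rw [eLpNorm_one_eq_lintegral_enorm, ← ofReal_integral_norm_eq_lintegral_enorm (hSi n)]
    refine ENNReal.ofReal_le_ofReal ?_
    have hle : ∑ t ∈ Finset.range n, b t ^ 2 ≤ ∑' t, b t ^ 2 :=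
      hsum.sum_le_tsum _ fun t _ => sq_nonneg _
    calc ∫ ω, ‖S n ω‖ ∂μ ≤ ∫ ω, (1 + S n ω ^ 2) ∂μ :=
          integral_mono (hSi n).norm ((integrable_const _).add (hsq (hSm' n) (hSb n))) fun ω => by
            change |S n ω| ≤ 1 + S n ω ^ 2
            rw [← sq_abs]
            nlinarith [sq_nonneg (|S n ω| - 1), abs_nonneg (S n ω)]
      _ = 1 + ∫ ω, S n ω ^ 2 ∂μ := by
          rw [integral_add (integrable_const _) (hsq (hSm' n) (hSb n))]; simp
      _ ≤ 1 + ∑' t, b t ^ 2 := by linarith [hL2 n]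
  exact hmart.submartingale.exists_ae_tendsto_of_bdd hL1

/-- Almost sure convergence of the weighted sum of the fluctuations of `φ (ℓ t, d t)` around its
conditional mean, when `d t` is independent of the past for `t ≥ k`. -/
theorem ae_tendsto_sum_fluctuation {E Y : Type*} [MeasurableSpace E] [MeasurableSpace Y]
    {ℱ : Filtration ℕ mΩ} {ℓ : ℕ → Ω → E} {d : ℕ → Ω → Y} {ν : Measure Y} {k : ℕ}
    (hℓ : ∀ n, Measurable[ℱ n] (ℓ n)) (hd : ∀ n, Measurable[ℱ (n + 1)] (d n))
    (hlaw : ∀ n, μ.map (d n) = ν)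
    (hind : ∀ n, k ≤ n → Indep (ℱ n) (MeasurableSpace.comap (d n) inferInstance) μ)
    {φ : E × Y → ℝ} (hφ : Measurable φ) {M : ℝ} (hM : ∀ x, |φ x| ≤ M) :
    ∀ᵐ ω ∂μ, ∃ l, Tendsto (fun n => ∑ t ∈ Finset.range n,
      if k ≤ t then (φ (ℓ t ω, d t ω) - ∫ y, φ (ℓ t ω, y) ∂ν) / ((t : ℝ) + 1) else 0)
      atTop (𝓝 l) := by
  have hdm : ∀ n, Measurable (d n) := fun n => (hd n).mono (ℱ.le _) le_rfl
  have hℓm : ∀ n, Measurable (ℓ n) := fun n => (hℓ n).mono (ℱ.le _) le_rfl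
  have : IsProbabilityMeasure ν := hlaw 0 ▸ Measure.isProbabilityMeasure_map (hdm 0).aemeasurable
  have hmean : Measurable fun e => ∫ y, φ (e, y) ∂ν :=
    hφ.stronglyMeasurable.integral_prod_right'.measurable
  have hmeanb : ∀ e, |∫ y, φ (e, y) ∂ν| ≤ M := fun e => by
    rw [← Real.norm_eq_abs]
    exact (norm_integral_le_of_norm_le_const (C := M)
      (Eventually.of_forall fun y => hM (e, y))).trans (by simp)
  have hM0 : 0 ≤ M := (abs_nonneg _).trans (hmeanb (ℓ 0 (Classical.choice (by
    have := (inferInstance : IsProbabilityMeasure μ).ne_zero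
    exact μ.nonempty_of_neZero))))
  refine ae_tendsto_sum_of_orthogonal (ℱ := ℱ) (b := fun t => 2 * M / ((t : ℝ) + 1))
    (ξ := fun t ω => if k ≤ t then (φ (ℓ t ω, d t ω) - ∫ y, φ (ℓ t ω, y) ∂ν) / ((t : ℝ) + 1)
      else 0) (fun n => ?_) (fun n ω => ?_) ?_ ?_
  · by_cases hn : k ≤ n
    · simp only [hn, if_true]
      have hℓ' : Measurable[ℱ (n + 1)] (ℓ n) := (hℓ n).mono (ℱ.mono n.le_succ) le_rfl
      exact ((hφ.comp (hℓ'.prodMk (hd n))).sub (hmean.comp hℓ')).div_const _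
    · simp only [hn, if_false]
      exact measurable_const
  · have hpos : (0 : ℝ) < (n : ℝ) + 1 := by positivity
    by_cases hn : k ≤ n
    · simp only [hn, if_true]
      rw [abs_div, abs_of_pos hpos]
      gcongr
      have h1 := abs_sub (φ (ℓ n ω, d n ω)) (∫ y, φ (ℓ n ω, y) ∂ν)
      linarith [hM (ℓ n ω, d n ω), hmeanb (ℓ n ω)]
    · simp only [hn, if_false, abs_zero]
      positivity
  · have h := (summable_nat_add_iff 1).2 (Real.summable_one_div_nat_pow.2 one_lt_two)
    refine (h.mul_left ((2 * M) ^ 2)).congr fun t => ?_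
    push_cast
    rw [div_pow]
    ring
  · rintro n ζ hζ ⟨c, hc⟩
    by_cases hn : k ≤ n
    · simp only [hn, if_true]
      have hζm : Measurable ζ := hζ.mono (ℱ.le n) le_rfl
      have hI : IndepFun (fun ω => (ζ ω, ℓ n ω)) (d n) μ :=
        indep_of_indep_of_le_left (hind n hn) (hζ.prodMk (hℓ n)).comap_le
      have key := integral_mul_of_indepFun hζm (hℓm n) (hdm n) hc hI hφ hM
      rw [hlaw n] at key
      have hc0 : ∀ ω, 0 ≤ c := fun ω => (abs_nonneg _).trans (hc ω)
      have i1 : Integrable (fun ω => ζ ω * φ (ℓ n ω, d n ω)) μ :=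
        Integrable.of_bound (hζm.mul (hφ.comp ((hℓm n).prodMk (hdm n)))).aestronglyMeasurable
          (c * M) (Eventually.of_forall fun ω => by
            rw [norm_mul]
            exact mul_le_mul (hc ω) (hM _) (norm_nonneg _) (hc0 ω))
      have i2 : Integrable (fun ω => ζ ω * ∫ y, φ (ℓ n ω, y) ∂ν) μ :=
        Integrable.of_bound (hζm.mul (hmean.comp (hℓm n))).aestronglyMeasurable
          (c * M) (Eventually.of_forall fun ω => by
            rw [norm_mul]
            exact mul_le_mul (hc ω) (hmeanb _) (norm_nonneg _) (hc0 ω))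
      have e : ∀ ω, ζ ω * ((φ (ℓ n ω, d n ω) - ∫ y, φ (ℓ n ω, y) ∂ν) / ((n : ℝ) + 1))
          = (ζ ω * φ (ℓ n ω, d n ω) - ζ ω * ∫ y, φ (ℓ n ω, y) ∂ν) / ((n : ℝ) + 1) := fun ω => by
        ring
      simp only [e]
      rw [integral_div, integral_sub i1 i2, key, sub_self, zero_div]
    · simp [hn]

end Martingale

lemma exists_tendsto_of_le_add {u a b : ℕ → ℝ} {N : ℕ} (hu : ∀ n, 0 ≤ u n)
    (hstep : ∀ n, N ≤ n → u (n + 1) - u n ≤ a n + b n)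
    (ha : ∃ l, Tendsto (fun n => ∑ t ∈ Finset.range n, a t) atTop (𝓝 l)) (hb : Summable b) :
    ∃ l, Tendsto u atTop (𝓝 l) := by
  obtain ⟨l, hl⟩ := ha
  have hP := (hl.add hb.hasSum.tendsto_sum_nat).comp (tendsto_add_atTop_nat N)
  set P : ℕ → ℝ := (fun n => ∑ t ∈ Finset.range n, a t + ∑ t ∈ Finset.range n, b t) ∘
    fun n => n + N with hPdef
  have hanti : Antitone fun n => u (n + N) - P n := by
    refine antitone_nat_of_succ_le fun n => ?_
    have h := hstep (n + N) (Nat.le_add_left N n)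
    have e : P (n + 1) = P n + (a (n + N) + b (n + N)) := by
      simp only [hPdef, Function.comp_apply, Nat.add_right_comm n 1 N, Finset.sum_range_succ]
      ring
    rw [e, Nat.add_right_comm]
    linarith
  obtain ⟨c, hc⟩ := hP.bddAbove_range
  have hbdd : BddBelow (Set.range fun n => u (n + N) - P n) := by
    refine ⟨-c, ?_⟩
    rintro _ ⟨n, rfl⟩
    have h1 := hc ⟨n, rfl⟩
    have h2 := hu (n + N)
    change -c ≤ u (n + N) - P n
    linarith
  have hlim := (tendsto_atTop_ciInf hanti hbdd).add hP
  simp only [sub_add_cancel] at hlim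
  exact ⟨_, (tendsto_add_atTop_iff_nat N).1 hlim⟩

section TruncatedCost

variable {p q : ℕ} {G : Finset (Finset (Fin p))} {lam1 lam2 : ℝ}

/-- A bound of the optimal cost of the frames in the ball of radius `R`. -/
noncomputable def costBound (p : ℕ) (R : ℝ) : ℝ := 1 / 2 * (p * R ^ 2)

lemma costBound_nonneg (p : ℕ) (R : ℝ) : 0 ≤ costBound p R := by
  unfold costBound
  positivity

lemma optCost_le_costBound (h1 : 0 < lam1) (h2 : 0 < lam2) {R : ℝ} {y : Fin p → ℝ}
    (hy : ‖y‖ ≤ R) (L : Matrix (Fin p) (Fin q) ℝ) :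
    optCost G lam1 lam2 y L ≤ costBound p R := by
  refine (optCost_le_half_sqNorm h1 h2 y L).trans ?_
  unfold costBound
  gcongr
  exact sqNorm_le_of_abs_le fun i => (norm_le_pi_norm y i).trans hy

lemma optCost_sub_le (h1 : 0 < lam1) (h2 : 0 < lam2) {R ε : ℝ} {y y' : Fin p → ℝ}
    (hy' : ‖y'‖ ≤ R) (hε : 0 < ε) (hε1 : ε ≤ 1) (hyy : ‖y - y'‖ ≤ ε)
    (L : Matrix (Fin p) (Fin q) ℝ) :
    optCost G lam1 lam2 y L - optCost G lam1 lam2 y' L ≤ (costBound p R + p) * ε := by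
  have h := optCost_perturb (G := G) h1 h2 hε y y' L
  have hb := optCost_le_costBound (G := G) h1 h2 hy' L
  have hs : sqNorm (y - y') ≤ p * ε ^ 2 :=
    sqNorm_le_of_abs_le fun i => (norm_le_pi_norm (y - y') i).trans hyy
  have h3 : 1 / 2 * (1 + 1 / ε) * sqNorm (y - y') ≤ 1 / 2 * (1 + 1 / ε) * (p * ε ^ 2) := by
    gcongr
  have h4 : 1 / 2 * (1 + 1 / ε) * (p * ε ^ 2) = p * ε * ((1 + ε) / 2) := by
    field_simp
    ring
  have h5 : (p : ℝ) * ε * ((1 + ε) / 2) ≤ p * ε * 1 := by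
    gcongr
    linarith
  have h6 := mul_le_mul_of_nonneg_left hb hε.le
  linarith

/-- The optimal cost, truncated at its bound on the ball of radius `R`. -/
noncomputable def truncCost (G : Finset (Finset (Fin p))) (lam1 lam2 R : ℝ)
    (x : (Fin p → Fin q → ℝ) × (Fin p → ℝ)) : ℝ :=
  min (optCost G lam1 lam2 x.2 (Matrix.of x.1)) (costBound p R)

lemma measurable_truncCost (h1 : 0 < lam1) (h2 : 0 < lam2) (R : ℝ) :
    Measurable (truncCost (q := q) G lam1 lam2 R) :=
  ((measurable_optCost h1 h2).comp measurable_swap).min measurable_const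

lemma abs_truncCost_le (h1 : 0 < lam1) (h2 : 0 < lam2) (R : ℝ)
    (x : (Fin p → Fin q → ℝ) × (Fin p → ℝ)) :
    |truncCost G lam1 lam2 R x| ≤ costBound p R := by
  rw [truncCost, abs_of_nonneg (le_min (optCost_nonneg h1 h2 _ _) (costBound_nonneg p R))]
  exact min_le_right _ _

lemma truncCost_eq (h1 : 0 < lam1) (h2 : 0 < lam2) {R : ℝ} {y : Fin p → ℝ} (hy : ‖y‖ ≤ R)
    (L : Fin p → Fin q → ℝ) :
    truncCost G lam1 lam2 R (L, y) = optCost G lam1 lam2 y (Matrix.of L) :=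
  min_eq_left (optCost_le_costBound h1 h2 hy _)

lemma isTame_truncCost (h1 : 0 < lam1) (h2 : 0 < lam2) (R : ℝ) (L : Fin p → Fin q → ℝ) :
    IsTame R (costBound p R) (costBound p R + p) fun y => truncCost G lam1 lam2 R (L, y) where
  measurable := (measurable_truncCost h1 h2 R).comp measurable_prodMk_left
  bound y _ := abs_truncCost_le h1 h2 R (L, y)
  variation y y' ε hy hy' hε hε1 hyy := by
    rw [truncCost_eq h1 h2 hy, truncCost_eq h1 h2 hy', abs_sub_le_iff]
    exact ⟨optCost_sub_le h1 h2 hy' hε hε1 hyy _,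
      optCost_sub_le h1 h2 hy hε hε1 (norm_sub_rev y y' ▸ hyy) _⟩

end TruncatedCost

section Filtration

variable {Ω : Type*} [mΩ : MeasurableSpace Ω] {μ : Measure Ω} [IsProbabilityMeasure μ]
  {α β : Type*} [MeasurableSpace α] [MeasurableSpace β]

/-- The filtration generated by `X` and, successively, by `d 0, d 1, …`. -/
def pastFiltration {X : Ω → α} {d : ℕ → Ω → β} (hX : Measurable X) (hd : ∀ i, Measurable (d i)) :
    Filtration ℕ mΩ where
  seq n := MeasurableSpace.comap X inferInstance ⊔
    ⨆ i : Fin n, MeasurableSpace.comap (d i) inferInstance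
  mono' _ n hmn := sup_le_sup le_rfl (iSup_le fun i =>
    le_iSup (fun i : Fin n => MeasurableSpace.comap (d i) inferInstance) (Fin.castLE hmn i))
  le' _ := sup_le hX.comap_le (iSup_le fun i => (hd i).comap_le)

lemma measurable_pastFiltration_left {X : Ω → α} {d : ℕ → Ω → β} (hX : Measurable X)
    (hd : ∀ i, Measurable (d i)) (n : ℕ) : Measurable[pastFiltration hX hd n] X :=
  measurable_iff_comap_le.2 le_sup_left

lemma measurable_pastFiltration {X : Ω → α} {d : ℕ → Ω → β} (hX : Measurable X)
    (hd : ∀ i, Measurable (d i)) {n i : ℕ} (hi : i < n) :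
    Measurable[pastFiltration hX hd n] (d i) :=
  measurable_iff_comap_le.2 (le_sup_of_le_right
    (le_iSup (fun i : Fin n => MeasurableSpace.comap (d i) inferInstance) ⟨i, hi⟩))

lemma indep_pastFiltration {X : Ω → α} {d : ℕ → Ω → β} (hX : Measurable X)
    (hd : ∀ i, Measurable (d i)) (hind : iIndepFun d μ) {k : ℕ}
    (hXd : IndepFun (fun ω => (X ω, fun i : Fin k => d i ω)) (fun ω => fun i : ℕ => d (k + i) ω) μ)
    {n : ℕ} (hn : k ≤ n) :
    Indep (pastFiltration hX hd n) (MeasurableSpace.comap (d n) inferInstance) μ := by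
  have hZ : Measurable fun ω => (X ω, fun i : Fin k => d i ω) :=
    hX.prodMk (measurable_pi_iff.2 fun i => hd i)
  have hY : Measurable fun ω => fun i : Fin (n - k) => d (k + i) ω :=
    measurable_pi_iff.2 fun i => hd _
  have hYd : IndepFun (fun ω => fun i : Fin (n - k) => d (k + i) ω) (d n) μ := by
    have h := hind.indepFun_finset (Finset.range n) {n} (by simp) hd
    have g1 : Measurable fun (v : Finset.range n → β) (i : Fin (n - k)) =>
        v ⟨k + i, Finset.mem_range.2 (by omega)⟩ :=
      measurable_pi_iff.2 fun i => measurable_pi_apply _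
    have g2 : Measurable fun v : ({n} : Finset ℕ) → β => v ⟨n, Finset.mem_singleton_self n⟩ :=
      measurable_pi_apply _
    exact h.comp g1 g2
  have hZY : IndepFun (fun ω => (X ω, fun i : Fin k => d i ω))
      (fun ω => (fun i : Fin (n - k) => d (k + i) ω, d n ω)) μ := by
    have g : Measurable fun v : ℕ → β => (fun i : Fin (n - k) => v i, v (n - k)) :=
      (measurable_pi_iff.2 fun i => measurable_pi_apply _).prodMk (measurable_pi_apply _)
    have h := hXd.comp measurable_id g
    have e : (fun v : ℕ → β => (fun i : Fin (n - k) => v i, v (n - k)))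
        ∘ (fun ω => fun i : ℕ => d (k + i) ω)
        = fun ω => (fun i : Fin (n - k) => d (k + i) ω, d n ω) := by
      funext ω
      simp only [Function.comp_apply, Nat.add_sub_cancel' hn]
    rw [e] at h
    exact h
  have hmain := indepFun_prodMk_left hZ hY (hd n) hZY hYd
  refine indep_of_indep_of_le_left hmain (sup_le ?_ (iSup_le fun i => ?_))
  · exact measurable_iff_comap_le.1
      ((measurable_fst.comp measurable_fst).comp (comap_measurable _))
  · by_cases hi : (i : ℕ) < k
    · have hm : Measurable fun x : (α × (Fin k → β)) × (Fin (n - k) → β) => x.1.2 ⟨i, hi⟩ :=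
        (measurable_pi_apply _).comp (measurable_snd.comp measurable_fst)
      exact measurable_iff_comap_le.1 (hm.comp (comap_measurable
          fun ω => ((X ω, fun i : Fin k => d i ω), fun i : Fin (n - k) => d (k + i) ω)))
    · have hm : Measurable fun x : (α × (Fin k → β)) × (Fin (n - k) → β) =>
          x.2 ⟨i - k, by omega⟩ := (measurable_pi_apply _).comp measurable_snd
      have e : d i = (fun x : (α × (Fin k → β)) × (Fin (n - k) → β) => x.2 ⟨i - k, by omega⟩) ∘
          fun ω => ((X ω, fun i : Fin k => d i ω), fun i : Fin (n - k) => d (k + i) ω) := by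
        funext ω
        simp only [Function.comp_apply]
        congr 1
        omega
      rw [e]
      exact measurable_iff_comap_le.1 (hm.comp (comap_measurable _))

end Filtration

end OLSD

theorem theorem1 {Ω : Type*} [MeasurableSpace Ω] (μ : Measure Ω) [IsProbabilityMeasure μ]
    (p q : ℕ) (G : Finset (Finset (Fin p))) (lam1 lam2 : ℝ) (hlam1 : 0 < lam1) (hlam2 : 0 < lam2)
    (d : ℕ → Ω → Fin p → ℝ) (hd_meas : ∀ t, Measurable (d t))
    (hd_indep : iIndepFun d μ) (hd_ident : ∀ t, IdentDistrib (d t) (d 0) μ μ)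
    (C : ℝ) (hd_bdd : ∀ t, ∀ᵐ ω ∂μ, ‖d t ω‖ ≤ C)
    (r : ℕ → Ω → Fin q → ℝ) (s : ℕ → Ω → Fin p → ℝ)
    (A : ℕ → Ω → Matrix (Fin q) (Fin q) ℝ) (B L : ℕ → Ω → Matrix (Fin p) (Fin q) ℝ)
    (hL0_meas : Measurable (fun ω => fun (i : Fin p) (j : Fin q) => L 0 ω i j))
    (k : ℕ)
    (hL0_indep : IndepFun (fun ω => (fun (i : Fin p) (j : Fin q) => L 0 ω i j, fun i : Fin k => d i ω))
      (fun ω => fun i : ℕ => d (k + i) ω) μ)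
    (hrun : ∀ ω, OLSD.IsRun G lam1 lam2 (fun t => d t ω) (fun t => r t ω) (fun t => s t ω)
      (fun t => A t ω) (fun t => B t ω) (fun t => L t ω)) :
    ∀ᵐ ω ∂μ, ∃ l : ℝ, Tendsto
      (fun t : ℕ => OLSD.surrogate G lam1 lam2 (fun i => d i ω) (fun i => r i ω)
        (fun i => s i ω) t (L t ω)) atTop (𝓝 l) := by
  have hbdd : ∀ t, ∀ᵐ ω ∂μ, ‖d t ω‖ ≤ |C| := fun t =>
    (hd_bdd t).mono fun ω h => h.trans (le_abs_self C)
  set R : ℝ := |C| + 2 with hR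
  set φ := OLSD.truncCost (q := q) G lam1 lam2 R with hφ
  obtain ⟨W, hW0, hWsum, hWle⟩ := OLSD.exists_summable_uniform_deviation (abs_nonneg C)
    (OLSD.costBound_nonneg p R) (add_nonneg (OLSD.costBound_nonneg p R) (Nat.cast_nonneg p))
    hd_meas hd_indep hd_ident hbdd
  have hfluct := OLSD.ae_tendsto_sum_fluctuation (μ := μ)
    (ℱ := OLSD.pastFiltration hL0_meas hd_meas)
    (ℓ := fun n ω => fun (i : Fin p) (j : Fin q) => L n ω i j) (d := d) (ν := μ.map (d 0)) (k := k)
    (fun n => (@OLSD.measurable_basis p q G lam1 lam2 Ω (OLSD.pastFiltration hL0_meas hd_meas n)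
      hlam1 hlam2 d r s A B L hrun (OLSD.measurable_pastFiltration_left hL0_meas hd_meas n) n
      fun i hi => OLSD.measurable_pastFiltration hL0_meas hd_meas hi).2)
    (fun n => OLSD.measurable_pastFiltration hL0_meas hd_meas n.lt_succ_self)
    (fun n => (hd_ident n).map_eq)
    (fun n hn => OLSD.indep_pastFiltration hL0_meas hd_meas hd_indep hL0_indep hn)
    (OLSD.measurable_truncCost hlam1 hlam2 R) (OLSD.abs_truncCost_le (G := G) hlam1 hlam2 R)
  filter_upwards [hfluct, hWsum, hWle, ae_all_iff.2 hbdd] with ω hω1 hω2 hω3 hω4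
  refine OLSD.exists_tendsto_of_le_add (N := k + 1)
    (fun n => OLSD.surrogate_nonneg hlam1 hlam2 n (L n ω)) (fun n hn => ?_) hω1 hω2
  have hn0 : 0 < n := by omega
  have hnk : k ≤ n := by omega
  have hstep := (hrun ω).surrogate_succ_sub_le hlam1 hlam2 hn0
  have hdev := hω3 n hn0 _ (OLSD.isTame_truncCost (G := G) hlam1 hlam2 R
    (fun (i : Fin p) (j : Fin q) => L n ω i j))
  have heq : ∀ i, φ (fun (i : Fin p) (j : Fin q) => L n ω i j, d i ω)
      = OLSD.optCost G lam1 lam2 (d i ω) (L n ω) := fun i =>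
    OLSD.truncCost_eq hlam1 hlam2 ((hω4 i).trans (by linarith)) _
  rw [← hφ] at hdev
  simp only [← heq] at hstep
  refine hstep.trans ?_
  simp only [hnk, if_true]
  rw [← add_div]
  gcongr
  linarith [le_of_abs_le hdev]
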